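/- Let $B_3(n)$ denote the number of triples $(\lambda_1,\lambda_2,\lambda_3)$ of partitions (the empty partition being allowed), the sum of all of whose parts is $n$, such that each $\lambda_i$ is a $3$-core, i.e. none of the hook numbers of $\lambda_i$ is a multiple of $3$. Let $\omega(n)$ denote the number of $(x_1,x_2,x_3,y_1,y_2,y_3)\in\mathbb{Z}^6$ with $$n=x_1^2+x_2^2+x_3^2+3y_1^2+3y_2^2+3y_3^2 .$$ Then, for every integer $n\ge 0$, $$\omega(12n+10)=6B_3(6n+4).$$ Moreover, with $f_k=\prod_{m=1}^{\infty}(1-q^{km})$, the following identity of formal power series in $q$ holds: $$\sum_{n=0}^{\infty}\omega(12n+10)q^n=144\,\frac{f_2^8f_3^3}{f_1^5}.$$ -/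

import Mathlib

namespace CoreTriples

/-- The Young diagram of a partition: its rows are the parts in nonincreasing order. -/
def youngDiagram {n : ℕ} (p : Nat.Partition n) : YoungDiagram :=
  YoungDiagram.ofRowLens (p.parts.sort (· ≥ ·)) (p.parts.pairwise_sort (· ≥ ·)).sortedGE

/-- The hook number of the cell `c = (i, j)` (row `i`, column `j`) of a Young diagram: the number of
cells to its right in its row, plus the number of cells below it in its column, plus one. -/
def hookNumber (μ : YoungDiagram) (c : ℕ × ℕ) : ℕ :=
  (μ.rowLen c.1 - c.2 - 1) + (μ.colLen c.2 - c.1 - 1) + 1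

/-- A partition is a `t`-core if none of its hook numbers is a multiple of `t`. -/
def IsCore (t : ℕ) {n : ℕ} (p : Nat.Partition n) : Prop :=
  ∀ c ∈ (youngDiagram p).cells, ¬ t ∣ hookNumber (youngDiagram p) c

/-- The partition triples of `n` with `t`-cores: triples of partitions (possibly empty), each of
them a `t`-core, such that the sum of all the parts is `n`. -/
def coreTriples (t n : ℕ) : Set (Fin 3 → Σ m : ℕ, Nat.Partition m) :=
  {l | (∑ i, (l i).2.parts.sum = n) ∧ ∀ i, IsCore t (l i).2}

/-- `B t n` is the number of partition triples of `n` with `t`-cores. -/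
noncomputable def B (t n : ℕ) : ℕ := (coreTriples t n).ncard

/-- The pairs `(x, y)` of integer triples with `x₁² + x₂² + x₃² + 3y₁² + 3y₂² + 3y₃² = n`. -/
def representations (n : ℕ) : Set ((Fin 3 → ℤ) × (Fin 3 → ℤ)) :=
  {v | ∑ i, v.1 i ^ 2 + ∑ i, 3 * v.2 i ^ 2 = (n : ℤ)}

/-- The number of representations of `n` by `x₁² + x₂² + x₃² + 3y₁² + 3y₂² + 3y₃²`. -/
noncomputable def omega (n : ℕ) : ℕ := (representations n).ncard

section EulerProduct

open PowerSeries
open scoped PowerSeries.WithPiTopology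

/-- The formal infinite product `f_k = ∏_{n ≥ 1} (1 - q^{kn})`, for `k ≥ 1`, as a power series in
the variable `q = X`; the product converges coefficientwise. -/
noncomputable def f (k : ℕ) : ℚ⟦X⟧ := ∏' n : ℕ, (1 - (X : ℚ⟦X⟧) ^ (k * (n + 1)))

/-- The product defining `f k` converges. -/
theorem multipliable_f {k : ℕ} (hk : 1 ≤ k) :
    Multipliable fun n : ℕ => (1 - (X : ℚ⟦X⟧) ^ (k * (n + 1))) := by
  simp_rw [sub_eq_add_neg]
  apply PowerSeries.WithPiTopology.multipliable_one_add_of_tendsto_order_atTop_nhds_top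
  refine ENat.tendsto_nhds_top_iff_natCast_lt.mpr fun n => ?_
  filter_upwards [Filter.eventually_ge_atTop n] with m hm
  rw [order_neg, order_X_pow]
  exact_mod_cast (by nlinarith : n < k * (m + 1))

end EulerProduct

end CoreTriples

/-! Both counts are coefficients of cubes: `omega` of `(phi * V 3 phi) ^ 3` and `B 3` of `coreSeries
^ 3`. Successive 2- and 3-dissections extract the required progressions, and both times what remains
is a multiple of ψ⁴ · `coreSeries`: 144 times it at 12n+10 (`coeff_phi_mul_phi_cube`), 24 times it
at 6n+4 (`coeff_coreSeries_cube`). The ratio is 6, and ψ = f₂²/f₁ with `coreSeries` = f₃³/f₁ gives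
the product.

Theta series are generating functions `gf` over ℤ, ℤ² or ℤ³, with weights equal to twice the
exponents so that n(n-1)/2 needs no division. Dissections and basic product relations come from
cutting a lattice into cosets and reindexing each one affinely. Two results need more: the level-six
pair `psi_cube_and_eis` and Gauss's `phiNeg_mul_f`. There the differences of the two sides satisfy
functional equations in q³ or q² that force their order of vanishing up without bound. The only
infinite product evaluated directly is Euler's, by the pentagonal number theorem (`f_one`).

A 3-core is a set of first column hook lengths closed under subtracting 3, hence a pair (c, d) of
runner lengths, and its size is c² - cd + d² + d. Three rotated copies of the quadrant ℕ² tile ℤ²,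
which turns the sum over 3-cores into a sum over a full lattice (`coreSeries_eq_gf`). -/

namespace CoreTriples

open PowerSeries

/-! ### Generating functions of weighted index sets -/

section GeneratingSeries

/-- The series whose `n`-th coefficient is the sum of `s i` over the `i` of weight `w i = 2 n`. -/
noncomputable def gf {ι : Type*} (w : ι → ℤ) (s : ι → ℚ) : ℚ⟦X⟧ :=
  PowerSeries.mk fun n => ∑ᶠ i, if w i = 2 * (n : ℤ) then s i else 0

/-- A weight that is nonnegative and even, and takes every value finitely often. -/
structure Proper {ι : Type*} (w : ι → ℤ) : Prop where
  nonneg : ∀ i, 0 ≤ w i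
  even : ∀ i, Even (w i)
  finite : ∀ n : ℤ, {i | w i = n}.Finite

variable {ι κ : Type*}

theorem coeff_gf (w : ι → ℤ) (s : ι → ℚ) (n : ℕ) :
    coeff n (gf w s) = ∑ᶠ i, if w i = 2 * (n : ℤ) then s i else 0 := by
  simp [gf]

/-- A `finsum` with infinite support is 0 by default; finite level sets are what make the
coefficients of `gf` genuine sums. -/
theorem Proper.support_finite {w : ι → ℤ} (hw : Proper w) (s : ι → ℚ) (n : ℕ) :
    (Function.support fun i => if w i = 2 * (n : ℤ) then s i else 0).Finite := by
  refine (hw.finite (2 * (n : ℤ))).subset fun i hi => ?_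
  by_contra h
  exact hi (if_neg h)

theorem Proper.comp {w : ι → ℤ} (hw : Proper w) {f : κ → ι} (hf : Function.Injective f) :
    Proper (w ∘ f) :=
  ⟨fun _ => hw.nonneg _, fun _ => hw.even _, fun n => (hw.finite n).preimage hf.injOn⟩

theorem Proper.congr {w w' : ι → ℤ} (hw : Proper w) (h : ∀ i, w' i = w i) : Proper w' := by
  rwa [funext h]

theorem Proper.finite_le {w : ι → ℤ} (hw : Proper w) (n : ℤ) : {i | w i ≤ n}.Finite := by
  refine ((Set.finite_Icc 0 n).biUnion fun m _ => hw.finite m).subset fun i hi => ?_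
  simp only [Set.mem_iUnion]
  exact ⟨w i, ⟨hw.nonneg i, hi⟩, rfl⟩

theorem Proper.add {w : ι → ℤ} {w' : κ → ℤ} (hw : Proper w) (hw' : Proper w') :
    Proper fun i : ι × κ => w i.1 + w' i.2 := by
  refine ⟨fun i => add_nonneg (hw.nonneg _) (hw'.nonneg _),
    fun i => (hw.even _).add (hw'.even _), fun n => ?_⟩
  refine ((hw.finite_le n).prod (hw'.finite_le n)).subset fun i hi => ?_
  have h1 := hw.nonneg i.1
  have h2 := hw'.nonneg i.2
  simp only [Set.mem_ofPred_eq, Set.mem_prod] at hi ⊢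
  constructor <;> linarith

theorem gf_congr {w w' : ι → ℤ} {s s' : ι → ℚ} (hw : ∀ i, w i = w' i) (hs : ∀ i, s i = s' i) :
    gf w s = gf w' s' := by
  rw [funext hw, funext hs]

theorem gf_reindex {w : ι → ℤ} {s : ι → ℚ} {w' : κ → ℤ} {s' : κ → ℚ} (f : ι → κ)
    (hf : Function.Bijective f) (hw : ∀ i, w' (f i) = w i) (hs : ∀ i, s' (f i) = s i) :
    gf w s = gf w' s' := by
  ext n
  rw [coeff_gf, coeff_gf]
  refine finsum_eq_of_bijective f hf fun i => ?_
  rw [hw, hs]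

theorem gf_smul (w : ι → ℤ) (s : ι → ℚ) (c : ℚ) :
    gf w (fun i => c * s i) = C c * gf w s := by
  ext n
  rw [coeff_C_mul, coeff_gf, coeff_gf, ← smul_eq_mul c, smul_finsum]
  refine finsum_congr fun i => ?_
  split_ifs <;> simp

theorem gf_add_weight (w : ι → ℤ) (s : ι → ℚ) (hw : ∀ i, 0 ≤ w i) (k : ℕ) :
    gf (fun i => w i + 2 * k) s = X ^ k * gf w s := by
  ext n
  rw [coeff_X_pow_mul', coeff_gf]
  split_ifs with h
  · rw [coeff_gf]
    refine finsum_congr fun i => ?_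
    have : w i + 2 * (k : ℤ) = 2 * (n : ℤ) ↔ w i = 2 * ((n - k : ℕ) : ℤ) := by omega
    simp only [this]
  · refine finsum_eq_zero_of_forall_eq_zero fun i => if_neg ?_
    have := hw i
    omega

theorem gf_expand {w : ι → ℤ} (hw : Proper w) (s : ι → ℚ) {k : ℕ} (hk : k ≠ 0) :
    gf (fun i => k * w i) s = expand k hk (gf w s) := by
  ext n
  rw [coeff_expand, coeff_gf]
  have hk' : (k : ℤ) ≠ 0 := by exact_mod_cast hk
  split_ifs with h
  · obtain ⟨m, rfl⟩ := h
    rw [Nat.mul_div_cancel_left _ (Nat.pos_of_ne_zero hk), coeff_gf]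
    refine finsum_congr fun i => ?_
    have : (k : ℤ) * w i = 2 * ((k * m : ℕ) : ℤ) ↔ w i = 2 * (m : ℤ) := by
      push_cast
      rw [mul_left_comm]
      exact mul_right_inj' hk'
    simp only [this]
  · refine finsum_eq_zero_of_forall_eq_zero fun i => if_neg fun hi => h ?_
    obtain ⟨c, hc⟩ := hw.even i
    rw [hc] at hi
    have : (n : ℤ) = k * c := by linarith
    exact_mod_cast Dvd.intro c this.symm

/-- Since both weights are even and nonnegative, each pair of indices meets exactly one point of ℕ ×
ℕ, and the antidiagonal test becomes the condition on the total weight. -/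
theorem gf_mul {w : ι → ℤ} {w' : κ → ℤ} (hw : Proper w) (hw' : Proper w') (s : ι → ℚ)
    (s' : κ → ℚ) :
    gf w s * gf w' s' = gf (fun i : ι × κ => w i.1 + w' i.2) fun i => s i.1 * s' i.2 := by
  ext n
  rw [coeff_mul, coeff_gf]
  have hterm : ∀ p : ℕ × ℕ, coeff p.1 (gf w s) * coeff p.2 (gf w' s') =
      ∑ᶠ i : ι × κ, if w i.1 = 2 * (p.1 : ℤ) ∧ w' i.2 = 2 * (p.2 : ℤ) then s i.1 * s' i.2
        else 0 := by
    intro p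
    rw [coeff_gf, coeff_gf, finsum_mul' _ _ (hw.support_finite s p.1)]
    rw [finsum_curry]
    · refine finsum_congr fun i => ?_
      rw [mul_finsum' _ _ (hw'.support_finite s' p.2)]
      refine finsum_congr fun j => ?_
      by_cases h1 : w i = 2 * (p.1 : ℤ) <;> by_cases h2 : w' j = 2 * (p.2 : ℤ) <;> simp [h1, h2]
    · refine ((hw.finite (2 * p.1)).prod (hw'.finite (2 * p.2))).subset fun i hi => ?_
      by_contra h
      exact hi (if_neg h)
  simp only [hterm]
  rw [← finsum_sum_comm]
  · refine finsum_congr fun i => ?_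
    obtain ⟨a, ha⟩ := hw.even i.1
    obtain ⟨b, hb⟩ := hw'.even i.2
    have ha0 := hw.nonneg i.1
    have hb0 := hw'.nonneg i.2
    have ha' : w i.1 = 2 * (a.toNat : ℤ) := by omega
    have hb' : w' i.2 = 2 * (b.toNat : ℤ) := by omega
    generalize a.toNat = a at ha'
    generalize b.toNat = b at hb'
    rw [ha', hb']
    have hiff : ∀ p : ℕ × ℕ, (2 * (a : ℤ) = 2 * (p.1 : ℤ) ∧ 2 * (b : ℤ) = 2 * (p.2 : ℤ)) ↔
        p = (a, b) := by
      intro p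
      rw [Prod.ext_iff]
      simp only
      omega
    simp only [hiff]
    rw [Finset.sum_ite_eq']
    have : (a, b) ∈ Finset.HasAntidiagonal.antidiagonal n ↔ 2 * (a : ℤ) + 2 * (b : ℤ) = 2 * (n : ℤ) := by
      rw [Finset.HasAntidiagonal.mem_antidiagonal]
      omega
    simp only [this]
  · intro p _
    refine ((hw.finite (2 * p.1)).prod (hw'.finite (2 * p.2))).subset fun i hi => ?_
    by_contra h
    exact hi (if_neg h)

/-- The tool for every dissection: the `f j` parametrize the pieces (usually cosets) of a partition
of the index set. -/
theorem gf_union {w : ι → ℤ} (hw : Proper w) {r : ℕ} (f : Fin r → κ → ι)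
    (hf : Function.Bijective fun p : Fin r × κ => f p.1 p.2) (s : ι → ℚ) :
    gf w s = ∑ j, gf (w ∘ f j) (s ∘ f j) := by
  ext n
  rw [map_sum, coeff_gf]
  simp only [coeff_gf]
  rw [← finsum_eq_of_bijective (fun p : Fin r × κ => f p.1 p.2) hf
    (f := fun p => if w (f p.1 p.2) = 2 * (n : ℤ) then s (f p.1 p.2) else 0) fun p => rfl]
  rw [finsum_curry, finsum_eq_sum_of_fintype]
  · rfl
  · exact (hw.support_finite s n).preimage hf.1.injOn

theorem gf_union_two {w : ι → ℤ} (hw : Proper w) (f g : κ → ι) (hf : Function.Injective f)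
    (hg : Function.Injective g) (hfg : ∀ k l, f k ≠ g l)
    (h : ∀ i, (∃ k, f k = i) ∨ ∃ k, g k = i) (s : ι → ℚ) :
    gf w s = gf (w ∘ f) (s ∘ f) + gf (w ∘ g) (s ∘ g) := by
  rw [gf_union hw ![f, g], Fin.sum_univ_two]
  · rfl
  · constructor
    · rintro ⟨i, k⟩ ⟨j, l⟩ hij
      fin_cases i <;> fin_cases j <;> simp_all [hf.eq_iff, hg.eq_iff, Prod.ext_iff]
      exact hfg l k hij.symm
    · intro i
      rcases h i with ⟨k, rfl⟩ | ⟨k, rfl⟩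
      · exact ⟨(0, k), rfl⟩
      · exact ⟨(1, k), rfl⟩

theorem gf_union_three {w : ι → ℤ} (hw : Proper w) (f g h : κ → ι) (hf : Function.Injective f)
    (hg : Function.Injective g) (hh : Function.Injective h) (hfg : ∀ k l, f k ≠ g l)
    (hfh : ∀ k l, f k ≠ h l) (hgh : ∀ k l, g k ≠ h l)
    (hc : ∀ i, (∃ k, f k = i) ∨ (∃ k, g k = i) ∨ ∃ k, h k = i) (s : ι → ℚ) :
    gf w s = gf (w ∘ f) (s ∘ f) + gf (w ∘ g) (s ∘ g) + gf (w ∘ h) (s ∘ h) := by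
  rw [gf_union hw ![f, g, h], Fin.sum_univ_three]
  · rfl
  · constructor
    · rintro ⟨i, k⟩ ⟨j, l⟩ hij
      fin_cases i <;> fin_cases j <;> simp_all [hf.eq_iff, hg.eq_iff, hh.eq_iff, Prod.ext_iff]
      · exact hfg l k hij.symm
      · exact hfh l k hij.symm
      · exact hgh l k hij.symm
    · intro i
      rcases hc i with ⟨k, rfl⟩ | ⟨k, rfl⟩ | ⟨k, rfl⟩
      · exact ⟨(0, k), rfl⟩
      · exact ⟨(1, k), rfl⟩
      · exact ⟨(2, k), rfl⟩

theorem coeff_gf_one {w : ι → ℤ} (hw : Proper w) (n : ℕ) :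
    coeff n (gf w fun _ => 1) = ({i | w i = 2 * (n : ℤ)}.ncard : ℚ) := by
  classical
  rw [coeff_gf, Set.ncard_eq_toFinset_card _ (hw.finite _), Finset.card_eq_sum_ones, Nat.cast_sum,
    finsum_eq_sum_of_support_subset (s := (hw.finite (2 * (n : ℤ))).toFinset)]
  · refine Finset.sum_congr rfl fun i hi => ?_
    rw [Set.Finite.mem_toFinset, Set.mem_ofPred_eq] at hi
    rw [if_pos hi, Nat.cast_one]
  · intro i hi
    rw [Set.Finite.coe_toFinset]
    by_contra h
    exact hi (if_neg h)

end GeneratingSeries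

/-! ### Theta series in one variable and their pairwise products -/

section ThetaSeries

/-- The substitution `q ↦ q ^ k`. -/
noncomputable def V (k : ℕ) [NeZero k] : ℚ⟦X⟧ →ₐ[ℚ] ℚ⟦X⟧ := expand k (NeZero.ne k)

theorem proper_theta {a b : ℤ} (ha : 0 ≤ a) (hab : a ≤ b) (hb : 0 < b) :
    Proper fun n : ℤ => b * (n * (n - 1)) + 2 * a * n := by
  have h1 : ∀ n : ℤ, 1 ≤ n → n * (n - 1) ≤ b * (n * (n - 1)) + 2 * a * n := by
    intro n hn
    have : 0 ≤ n * (n - 1) := mul_nonneg (by omega) (by omega)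
    nlinarith [mul_nonneg ha (by omega : 0 ≤ n)]
  have h2 : ∀ n : ℤ, n ≤ 0 → n * (n + 1) ≤ b * (n * (n - 1)) + 2 * a * n := by
    intro n hn
    have h : 0 ≤ n * (n + 1) := by
      rcases eq_or_lt_of_le hn with rfl | hn
      · simp
      · nlinarith
    nlinarith [mul_nonneg (by omega : 0 ≤ b - a) (by omega : 0 ≤ -n),
      mul_nonneg (by omega : 0 ≤ b - 1) h]
  refine ⟨fun n => ?_, fun n => ?_, fun N => ?_⟩
  · rcases le_or_gt 1 n with hn | hn
    · exact (mul_nonneg (by omega) (by omega)).trans (h1 n hn)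
    · refine le_trans ?_ (h2 n (by omega))
      rcases eq_or_lt_of_le (show n ≤ 0 by omega) with rfl | hn
      · simp
      · nlinarith
  · rw [mul_assoc]
    exact ((Int.even_mul_pred_self n).mul_left b).add (even_two_mul _)
  · refine (Set.finite_Icc (-(N + 2)) (N + 2)).subset fun n hn => ?_
    rw [Set.mem_ofPred_eq] at hn
    rw [Set.mem_Icc]
    rcases le_or_gt 1 n with h | h
    · have := h1 n h
      constructor <;> nlinarith
    · have := h2 n (by omega)
      constructor <;> nlinarith [sq_nonneg (n + 1)]

/-- The theta series `∑ ε ^ n q ^ (b n (n - 1) / 2 + a n)`, the sum being over all integers. -/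
noncomputable def J (ε : ℚ) (a b : ℤ) : ℚ⟦X⟧ :=
  gf (fun n : ℤ => b * (n * (n - 1)) + 2 * a * n) fun n => ε ^ n

theorem J_reflect (ε : ℚ) (hε : ε = 1 ∨ ε = -1) (a b : ℤ) : J ε (b - a) b = J ε a b := by
  refine gf_reindex Neg.neg neg_involutive.bijective (fun n => by ring) fun n => ?_
  rcases hε with rfl | rfl <;> simp [← inv_zpow]

theorem J_scale (k : ℕ) [NeZero k] (ε : ℚ) {a b : ℤ} (ha : 0 ≤ a) (hab : a ≤ b) (hb : 0 < b) :
    J ε (k * a) (k * b) = V k (J ε a b) := by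
  rw [V, J, J, ← gf_expand (proper_theta ha hab hb)]
  exact gf_congr (fun n => by ring) fun n => rfl

/-- Group the pairs (m, n) by k = m + n. The sign depends on k only, and for either parity of k the
sum over the transverse direction is the same series `J 1 (3 * b) (4 * b)`; the first factor on the
right is the sum over k. -/
theorem theta_mul_two (ε : ℚ) (hε : ε ≠ 0) {a b : ℤ} (ha : 0 ≤ a) (hab : a ≤ b) (hb : 0 < b) :
    J ε a (2 * b) * J ε (a + b) (2 * b) = J ε a b * J 1 (3 * b) (4 * b) := by
  have p1 := proper_theta ha (by omega : a ≤ 2 * b) (by omega)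
  have p2 := proper_theta (by omega : 0 ≤ a + b) (by omega : a + b ≤ 2 * b) (by omega)
  have p3 := proper_theta ha hab hb
  have p4 := proper_theta (by omega : 0 ≤ 3 * b) (by omega : 3 * b ≤ 4 * b) (by omega)
  simp only [J]
  rw [gf_mul p1 p2, gf_mul p3 p4,
    gf_union_two (p1.add p2) (fun v : ℤ × ℤ => (v.1 - v.2, v.1 + v.2))
      (fun v : ℤ × ℤ => (v.1 + v.2 + 1, v.1 - v.2)),
    gf_union_two (p3.add p4) (fun v : ℤ × ℤ => (2 * v.1, v.2))
      (fun v : ℤ × ℤ => (2 * v.1 + 1, v.2))]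
  · congr 1
    · refine gf_congr (fun v => ?_) fun v => ?_
      · simp only [Function.comp_apply]; ring
      · simp only [Function.comp_apply, one_zpow, mul_one, ← zpow_add₀ hε]; congr 1; ring
    · refine gf_congr (fun v => ?_) fun v => ?_
      · simp only [Function.comp_apply]; ring
      · simp only [Function.comp_apply, one_zpow, mul_one, ← zpow_add₀ hε]; congr 1; ring
  · rintro ⟨x, y⟩ ⟨z, w⟩ h
    simp only [Prod.mk.injEq] at h ⊢
    omega
  · rintro ⟨x, y⟩ ⟨z, w⟩ h
    simp only [Prod.mk.injEq] at h ⊢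
    omega
  · rintro ⟨x, y⟩ ⟨z, w⟩ h
    simp only [Prod.mk.injEq] at h
    omega
  · rintro ⟨x, y⟩
    rcases Int.even_or_odd' x with ⟨k, rfl | rfl⟩
    · exact Or.inl ⟨(k, y), rfl⟩
    · exact Or.inr ⟨(k, y), rfl⟩
  · rintro ⟨x, y⟩ ⟨z, w⟩ h
    simp only [Prod.mk.injEq] at h ⊢
    omega
  · rintro ⟨x, y⟩ ⟨z, w⟩ h
    simp only [Prod.mk.injEq] at h ⊢
    omega
  · rintro ⟨x, y⟩ ⟨z, w⟩ h
    simp only [Prod.mk.injEq] at h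
    omega
  · rintro ⟨x, y⟩
    rcases Int.even_or_odd' (x + y) with ⟨k, h | h⟩
    · refine Or.inl ⟨(k, y - k), ?_⟩
      simp only [Prod.mk.injEq]
      omega
    · refine Or.inr ⟨(k, k - y), ?_⟩
      simp only [Prod.mk.injEq]
      omega

/-- Split by the parity of m + n. The weight is symmetric and the sign is (-1)ⁿ, so exchanging m and
n cancels the odd class; the even class factors in the coordinates (m+n)/2 and (n-m)/2. -/
theorem theta_mul_neg {a b : ℤ} (ha : 0 ≤ a) (hab : a ≤ b) (hb : 0 < b) :
    J 1 a b * J (-1) a b = J (-1) (2 * a) (2 * b) * J (-1) b (2 * b) := by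
  have p1 := proper_theta ha hab hb
  have p3 := proper_theta (by omega : 0 ≤ 2 * a) (by omega : 2 * a ≤ 2 * b) (by omega)
  have p4 := proper_theta hb.le (by omega : b ≤ 2 * b) (by omega)
  simp only [J]
  rw [gf_mul p1 p1, gf_mul p3 p4,
    gf_union_two (p1.add p1) (fun v : ℤ × ℤ => (v.1 - v.2, v.1 + v.2))
      (fun v : ℤ × ℤ => (v.1 + v.2 + 1, v.1 - v.2))]
  · have hodd : ∀ F : ℚ⟦X⟧, F = C (-1) * F → F = 0 := by
      intro F hF
      have : C (2 : ℚ) * F = 0 := by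
        have h2 : (C (2 : ℚ) : ℚ⟦X⟧) = 1 - C (-1) := by
          rw [← map_one (C (R := ℚ)), ← map_sub]; norm_num
        rw [h2, sub_mul, one_mul, ← hF, sub_self]
      refine (mul_eq_zero.mp this).resolve_left fun h => ?_
      simpa using congrArg constantCoeff h
    rw [hodd (gf _ ((fun i : ℤ × ℤ => (1 : ℚ) ^ i.1 * (-1) ^ i.2) ∘
      fun v : ℤ × ℤ => (v.1 + v.2 + 1, v.1 - v.2))), add_zero]
    · refine gf_congr (fun v => ?_) fun v => ?_
      · simp only [Function.comp_apply]; ring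
      · simp only [Function.comp_apply, one_zpow, one_mul,
          ← zpow_add₀ (show (-1 : ℚ) ≠ 0 by norm_num)]
    · rw [← gf_smul]
      -- In these coordinates this reflection is the exchange of m and n.
      refine gf_reindex (fun v : ℤ × ℤ => (v.1, -v.2 - 1)) ?_ (fun v => ?_) fun v => ?_
      · refine Function.Involutive.bijective fun v => ?_
        simp
      · simp only [Function.comp_apply]; ring
      · simp only [Function.comp_apply, one_zpow, one_mul]
        rw [show v.1 - (-v.2 - 1) = v.1 - v.2 + (2 * v.2 + 1) by ring,
          zpow_add₀ (by norm_num), (odd_two_mul_add_one v.2).neg_one_zpow]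
        ring
  · rintro ⟨x, y⟩ ⟨z, w⟩ h
    simp only [Prod.mk.injEq] at h ⊢
    omega
  · rintro ⟨x, y⟩ ⟨z, w⟩ h
    simp only [Prod.mk.injEq] at h ⊢
    omega
  · rintro ⟨x, y⟩ ⟨z, w⟩ h
    simp only [Prod.mk.injEq] at h
    omega
  · rintro ⟨x, y⟩
    rcases Int.even_or_odd' (x + y) with ⟨k, h | h⟩
    · refine Or.inl ⟨(k, y - k), ?_⟩
      simp only [Prod.mk.injEq]
      omega
    · refine Or.inr ⟨(k, k - y), ?_⟩
      simp only [Prod.mk.injEq]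
      omega

end ThetaSeries

/-! ### Theta series of the Eisenstein lattice and triple products -/

section Eisenstein

theorem proper_eis : Proper fun v : ℤ × ℤ => 2 * (v.1 ^ 2 - v.1 * v.2 + v.2 ^ 2) := by
  refine ⟨fun v => ?_, fun v => even_two_mul _, fun N => ?_⟩
  · nlinarith [sq_nonneg (v.1 - v.2), sq_nonneg v.1, sq_nonneg v.2]
  · refine ((Set.finite_Icc (-(N + 2)) (N + 2)).prod
      (Set.finite_Icc (-(N + 2)) (N + 2))).subset fun v hv => ?_
    rw [Set.mem_ofPred_eq] at hv
    simp only [Set.mem_prod, Set.mem_Icc]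
    refine ⟨⟨?_, ?_⟩, ?_, ?_⟩ <;>
      nlinarith [sq_nonneg (2 * v.1 - v.2), sq_nonneg (2 * v.2 - v.1), sq_nonneg (v.1 - 1),
        sq_nonneg (v.1 + 1), sq_nonneg (v.2 - 1), sq_nonneg (v.2 + 1)]

theorem proper_eisShift :
    Proper fun v : ℤ × ℤ => 2 * (v.1 ^ 2 - v.1 * v.2 + v.2 ^ 2 + v.2) := by
  refine ⟨fun v => ?_, fun v => even_two_mul _, fun N => ?_⟩
  · have h1 : 0 ≤ v.2 * (v.2 + 1) := by
      rcases le_or_gt 0 v.2 with h | h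
      · positivity
      · nlinarith
    have h2 : 0 ≤ v.1 * (v.1 + 1) := by
      rcases le_or_gt 0 v.1 with h | h
      · positivity
      · nlinarith
    have h3 : 0 ≤ (v.1 - v.2) * (v.1 - v.2 - 1) := by
      rcases le_or_gt 1 (v.1 - v.2) with h | h
      · exact mul_nonneg (by omega) (by omega)
      · nlinarith
    nlinarith
  · refine ((Set.finite_Icc (-(N + 4)) (N + 4)).prod
      (Set.finite_Icc (-(N + 4)) (N + 4))).subset fun v hv => ?_
    rw [Set.mem_ofPred_eq] at hv
    simp only [Set.mem_prod, Set.mem_Icc]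
    refine ⟨⟨?_, ?_⟩, ?_, ?_⟩ <;>
      nlinarith [sq_nonneg (2 * v.1 - v.2), sq_nonneg (2 * v.2 - v.1 + 1), sq_nonneg (v.1 - 1),
        sq_nonneg (v.1 + 1), sq_nonneg (v.2 - 1), sq_nonneg (v.2 + 1)]

theorem proper_eisCore {b : ℤ} (hb : 0 < b) :
    Proper fun v : ℤ × ℤ =>
      2 * b * (3 * (v.1 ^ 2 + v.1 * v.2 + v.2 ^ 2) + v.1 + 2 * v.2) := by
  have h := proper_eisShift.comp (f := fun v : ℤ × ℤ => (v.2 - v.1, v.1 + 2 * v.2)) (by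
    rintro ⟨x, y⟩ ⟨z, w⟩ h
    simp only [Prod.mk.injEq] at h ⊢
    omega)
  have h' : Proper fun v : ℤ × ℤ =>
      2 * (3 * (v.1 ^ 2 + v.1 * v.2 + v.2 ^ 2) + v.1 + 2 * v.2) :=
    h.congr fun v => by simp only [Function.comp_apply]; ring
  refine ⟨fun v => ?_, fun v => ?_, fun N => ?_⟩
  · have := mul_nonneg hb.le (h'.nonneg v)
    linarith
  · rw [mul_assoc]
    exact even_two_mul _
  · refine (h'.finite_le N).subset fun v hv => ?_
    rw [Set.mem_ofPred_eq] at hv ⊢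
    nlinarith [h'.nonneg v]

/-- The theta series of the lattice of Eisenstein integers. -/
noncomputable def eis : ℚ⟦X⟧ :=
  gf (fun v : ℤ × ℤ => 2 * (v.1 ^ 2 - v.1 * v.2 + v.2 ^ 2)) fun _ => 1

/-- The theta series of a shifted lattice of Eisenstein integers. -/
noncomputable def eisShift : ℚ⟦X⟧ :=
  gf (fun v : ℤ × ℤ => 2 * (v.1 ^ 2 - v.1 * v.2 + v.2 ^ 2 + v.2)) fun _ => 1

/-- The generating series of `3`-cores, as a sum over the lattice `A₂`. -/
noncomputable def coreSeries : ℚ⟦X⟧ :=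
  gf (fun v : ℤ × ℤ => 2 * (3 * (v.1 ^ 2 + v.1 * v.2 + v.2 ^ 2) + v.1 + 2 * v.2)) fun _ => 1

/-- The series `ψ(q) = ∑ q ^ (n (n + 1) / 2)`, the sum being over the natural numbers. -/
noncomputable def psi : ℚ⟦X⟧ := J 1 3 4

/-- The series `∑ q ^ (n (3 n - 1) / 2)`, the sum being over all integers. -/
noncomputable def pent : ℚ⟦X⟧ := J 1 1 3

/-- The form x² - xy + y² + y is invariant under the rotation (x, y) ↦ (-1-y, x-y-1) of order 3
about (-1/3, -2/3). This rotation permutes cyclically the three classes of x + y mod 3, and the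
class 0 is `coreSeries`. -/
theorem eisShift_eq_coreSeries : eisShift = 3 * coreSeries := by
  rw [eisShift, gf_union_three proper_eisShift (fun v : ℤ × ℤ => (v.2 - v.1, v.1 + 2 * v.2))
    (fun v : ℤ × ℤ => (-1 - (v.1 + 2 * v.2), v.2 - v.1 - (v.1 + 2 * v.2) - 1))
    (fun v : ℤ × ℤ => (-1 - (v.2 - v.1 - (v.1 + 2 * v.2) - 1), -1 - (v.1 + 2 * v.2) -
      (v.2 - v.1 - (v.1 + 2 * v.2) - 1) - 1))]
  · rw [show (3 : ℚ⟦X⟧) * coreSeries = coreSeries + coreSeries + coreSeries by ring]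
    congr 1
    · congr 1
      · exact gf_congr (fun v => by simp only [Function.comp_apply]; ring) fun v => rfl
      · exact gf_congr (fun v => by simp only [Function.comp_apply]; ring) fun v => rfl
    · exact gf_congr (fun v => by simp only [Function.comp_apply]; ring) fun v => rfl
  · rintro ⟨x, y⟩ ⟨z, w⟩ h
    simp only [Prod.mk.injEq] at h ⊢
    omega
  · rintro ⟨x, y⟩ ⟨z, w⟩ h
    simp only [Prod.mk.injEq] at h ⊢
    omega
  · rintro ⟨x, y⟩ ⟨z, w⟩ h
    simp only [Prod.mk.injEq] at h ⊢
    omega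
  · rintro ⟨x, y⟩ ⟨z, w⟩ h
    simp only [Prod.mk.injEq] at h
    omega
  · rintro ⟨x, y⟩ ⟨z, w⟩ h
    simp only [Prod.mk.injEq] at h
    omega
  · rintro ⟨x, y⟩ ⟨z, w⟩ h
    simp only [Prod.mk.injEq] at h
    omega
  · rintro ⟨x, y⟩
    have : (x + y) % 3 = 0 ∨ (x + y) % 3 = 1 ∨ (x + y) % 3 = 2 := by omega
    rcases this with h | h | h
    · refine Or.inl ⟨(y - 2 * ((x + y) / 3), (x + y) / 3), ?_⟩
      simp only [Prod.mk.injEq]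
      omega
    · refine Or.inr (Or.inl ⟨(-1 - x - 2 * ((y - 2 * x - 1) / 3), (y - 2 * x - 1) / 3), ?_⟩)
      simp only [Prod.mk.injEq]
      omega
    · refine Or.inr (Or.inr ⟨(x - y - 1 - 2 * ((x - 2 * y - 2) / 3), (x - 2 * y - 2) / 3), ?_⟩)
      simp only [Prod.mk.injEq]
      omega

/-- Group the triples by the sum k of their entries. For each residue of k mod 3 the transverse sum
is the same A₂ series, up to a cyclic shift of the coordinates, and the sum over k is `J ε a b`. -/
theorem theta_mul_three (ε : ℚ) (hε : ε ≠ 0) {a b : ℤ} (ha : 0 ≤ a) (hab : a ≤ b) (hb : 0 < b) :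
    J ε a (3 * b) * J ε (a + b) (3 * b) * J ε (a + 2 * b) (3 * b) = J ε a b *
      gf (fun v : ℤ × ℤ => 2 * b * (3 * (v.1 ^ 2 + v.1 * v.2 + v.2 ^ 2) + v.1 + 2 * v.2))
        fun _ => 1 := by
  have p1 := proper_theta ha (by omega : a ≤ 3 * b) (by omega)
  have p2 := proper_theta (by omega : 0 ≤ a + b) (by omega : a + b ≤ 3 * b) (by omega)
  have p3 := proper_theta (by omega : 0 ≤ a + 2 * b) (by omega : a + 2 * b ≤ 3 * b) (by omega)
  have p4 := proper_theta ha hab hb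
  have p5 := proper_eisCore hb
  simp only [J]
  rw [gf_mul p1 p2, gf_mul (p1.add p2) p3, gf_mul p4 p5,
    gf_union_three ((p1.add p2).add p3)
      (fun v : ℤ × ℤ × ℤ => ((v.1 - v.2.1 - v.2.2, v.1 + v.2.1), v.1 + v.2.2))
      (fun v : ℤ × ℤ × ℤ => ((v.1 + v.2.2 + 1, v.1 - v.2.1 - v.2.2), v.1 + v.2.1))
      (fun v : ℤ × ℤ × ℤ => ((v.1 + v.2.1 + 1, v.1 + v.2.2 + 1), v.1 - v.2.1 - v.2.2)),
    gf_union_three (p4.add p5) (fun v : ℤ × ℤ × ℤ => (3 * v.1, v.2))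
      (fun v : ℤ × ℤ × ℤ => (3 * v.1 + 1, v.2)) (fun v : ℤ × ℤ × ℤ => (3 * v.1 + 2, v.2))]
  · congr 1
    · congr 1
      · refine gf_congr (fun v => ?_) fun v => ?_
        · simp only [Function.comp_apply]; ring
        · simp only [Function.comp_apply, mul_one, ← zpow_add₀ hε]; congr 1; ring
      · refine gf_congr (fun v => ?_) fun v => ?_
        · simp only [Function.comp_apply]; ring
        · simp only [Function.comp_apply, mul_one, ← zpow_add₀ hε]; congr 1; ring
    · refine gf_congr (fun v => ?_) fun v => ?_
      · simp only [Function.comp_apply]; ring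
      · simp only [Function.comp_apply, mul_one, ← zpow_add₀ hε]; congr 1; ring
  · rintro ⟨x, y⟩ ⟨z, w⟩ h
    simp only [Prod.mk.injEq] at h ⊢
    exact ⟨by omega, h.2⟩
  · rintro ⟨x, y⟩ ⟨z, w⟩ h
    simp only [Prod.mk.injEq] at h ⊢
    exact ⟨by omega, h.2⟩
  · rintro ⟨x, y⟩ ⟨z, w⟩ h
    simp only [Prod.mk.injEq] at h ⊢
    exact ⟨by omega, h.2⟩
  · rintro ⟨x, y⟩ ⟨z, w⟩ h
    simp only [Prod.mk.injEq] at h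
    omega
  · rintro ⟨x, y⟩ ⟨z, w⟩ h
    simp only [Prod.mk.injEq] at h
    omega
  · rintro ⟨x, y⟩ ⟨z, w⟩ h
    simp only [Prod.mk.injEq] at h
    omega
  · rintro ⟨x, y⟩
    have : x = 3 * (x / 3) ∨ x = 3 * (x / 3) + 1 ∨ x = 3 * (x / 3) + 2 := by omega
    rcases this with h | h | h
    · exact Or.inl ⟨(x / 3, y), Prod.ext h.symm rfl⟩
    · exact Or.inr (Or.inl ⟨(x / 3, y), Prod.ext h.symm rfl⟩)
    · exact Or.inr (Or.inr ⟨(x / 3, y), Prod.ext h.symm rfl⟩)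
  · rintro ⟨x, y, z⟩ ⟨x', y', z'⟩ h
    simp only [Prod.mk.injEq] at h ⊢
    omega
  · rintro ⟨x, y, z⟩ ⟨x', y', z'⟩ h
    simp only [Prod.mk.injEq] at h ⊢
    omega
  · rintro ⟨x, y, z⟩ ⟨x', y', z'⟩ h
    simp only [Prod.mk.injEq] at h ⊢
    omega
  · rintro ⟨x, y, z⟩ ⟨x', y', z'⟩ h
    simp only [Prod.mk.injEq] at h
    omega
  · rintro ⟨x, y, z⟩ ⟨x', y', z'⟩ h
    simp only [Prod.mk.injEq] at h
    omega
  · rintro ⟨x, y, z⟩ ⟨x', y', z'⟩ h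
    simp only [Prod.mk.injEq] at h
    omega
  · rintro ⟨⟨x, y⟩, z⟩
    obtain ⟨t, ht⟩ : ∃ t, t = (x + y + z) / 3 := ⟨_, rfl⟩
    have : x + y + z = 3 * t ∨ x + y + z = 3 * t + 1 ∨ x + y + z = 3 * t + 2 := by omega
    rcases this with h | h | h
    · refine Or.inl ⟨(t, y - t, z - t), ?_⟩
      simp only [Prod.mk.injEq]
      omega
    · refine Or.inr (Or.inl ⟨(t, z - t, x - t - 1), ?_⟩)
      simp only [Prod.mk.injEq]
      omega
    · refine Or.inr (Or.inr ⟨(t, x - t - 1, y - t - 1), ?_⟩)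
      simp only [Prod.mk.injEq]
      omega

end Eisenstein

/-! ### 3-dissections of ψ and of the Eisenstein theta series -/

section Dissections

theorem two_ne_zero_series : (2 : ℚ⟦X⟧) ≠ 0 :=
  fun h => by simpa [map_ofNat] using congrArg (constantCoeff (R := ℚ)) h

/-- As n runs over ℤ, n(n-1)/2 takes each triangular number twice, while 2n² + n takes each once. -/
theorem J_zero_one : J 1 0 1 = 2 * psi := by
  rw [J, gf_union_two (proper_theta le_rfl zero_le_one one_pos) (fun n : ℤ => 2 * n)
    (fun n : ℤ => 1 - 2 * n), show 2 * psi = psi + psi from two_mul _]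
  · congr 1
    · refine gf_reindex (fun n : ℤ => -n) neg_involutive.bijective
        (fun n => by simp only [Function.comp_apply]; ring) fun n => by simp
    · refine gf_reindex (fun n : ℤ => -n) neg_involutive.bijective
        (fun n => by simp only [Function.comp_apply]; ring) fun n => by simp
  · intro x y h
    simp only at h
    omega
  · intro x y h
    simp only at h
    omega
  · intro x y
    omega
  · intro x
    rcases Int.even_or_odd' x with ⟨k, rfl | rfl⟩
    · exact Or.inl ⟨k, rfl⟩
    · exact Or.inr ⟨-k, by ring⟩

theorem gf_eq_V {ι : Type*} {w w' : ι → ℤ} (hw : Proper w) (k : ℕ) [NeZero k]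
    (h : ∀ i, w' i = k * w i) (s : ι → ℚ) : gf w' s = V k (gf w s) := by
  rw [V, ← gf_expand hw, funext h]

theorem gf_eq_X_mul_V {ι : Type*} {w w' : ι → ℤ} (hw : Proper w) (k : ℕ) [NeZero k]
    (h : ∀ i, w' i = k * w i + 2) (s : ι → ℚ) : gf w' s = X * V k (gf w s) := by
  have := gf_add_weight (fun i => k * w i) s
    (fun i => mul_nonneg (Int.natCast_nonneg k) (hw.nonneg i)) 1
  rw [V, ← gf_expand hw, ← pow_one (X : ℚ⟦X⟧), ← this]
  exact gf_congr (fun i => by rw [h]; push_cast; ring) fun i => rfl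

theorem proper_pent : Proper fun n : ℤ => 3 * (n * (n - 1)) + 2 * 1 * n :=
  proper_theta (by norm_num) (by norm_num) (by norm_num)

theorem proper_zero_one : Proper fun n : ℤ => 1 * (n * (n - 1)) + 2 * 0 * n :=
  proper_theta (by norm_num) (by norm_num) (by norm_num)

/-- The `3`-dissection of `ψ`. -/
theorem psi_dissection : psi = V 3 pent + X * V 3 (V 3 psi) := by
  have h : (2 : ℚ⟦X⟧) * psi = 2 * (V 3 pent + X * V 3 (V 3 psi)) := by
    have h2 : (2 : ℚ⟦X⟧) * (V 3 pent + X * V 3 (V 3 psi)) =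
        V 3 pent + V 3 pent + X * V 3 (V 3 (2 * psi)) := by
      simp only [map_mul, map_ofNat]; ring
    rw [h2, ← J_zero_one]
    conv_lhs => rw [J]
    -- The classes 0 and 1 mod 3 are exchanged by n ↦ 1 - n and each gives `pent`; the class 2
    -- contains the fixed class of that symmetry and reproduces the full sum at q⁹.
    rw [gf_union_three proper_zero_one (fun n : ℤ => 3 * n)
      (fun n : ℤ => 1 - 3 * n) (fun n : ℤ => 3 * n + 2)]
    · congr 1
      · congr 1
        · refine Eq.trans ?_ (gf_eq_V proper_pent 3 (fun n => rfl) _)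
          exact gf_reindex (fun n : ℤ => n) Function.bijective_id
            (fun n => by simp only [Function.comp_apply]; push_cast; ring) fun n => by simp
        · refine Eq.trans ?_ (gf_eq_V proper_pent 3 (fun n => rfl) _)
          exact gf_reindex (fun n : ℤ => n) Function.bijective_id
            (fun n => by simp only [Function.comp_apply]; push_cast; ring) fun n => by simp
      · rw [J, ← gf_eq_V proper_zero_one 3 fun n => rfl]
        have hp : Proper fun n : ℤ => ((3 : ℕ) : ℤ) * (1 * (n * (n - 1)) + 2 * 0 * n) :=
          (proper_theta le_rfl (by norm_num) (by norm_num : (0:ℤ) < 3)).congr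
            fun n => by push_cast; ring
        rw [← gf_eq_X_mul_V hp 3 fun n => rfl]
        refine gf_reindex (fun n : ℤ => n + 1) (Equiv.addRight (1 : ℤ)).bijective
          (fun n => by simp only [Function.comp_apply]; push_cast; ring) fun n => by simp
    · intro x y h
      simp only at h
      omega
    · intro x y h
      simp only at h
      omega
    · intro x y h
      simp only at h
      omega
    · intro x y
      omega
    · intro x y
      omega
    · intro x y
      omega
    · intro x
      have : x % 3 = 0 ∨ x % 3 = 1 ∨ x % 3 = 2 := by omega
      rcases this with h | h | h
      · exact Or.inl ⟨x / 3, by omega⟩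
      · exact Or.inr (Or.inl ⟨-(x / 3), by omega⟩)
      · exact Or.inr (Or.inr ⟨x / 3, by omega⟩)
  exact mul_left_cancel₀ two_ne_zero_series h

/-- The `3`-dissection of the theta series of the Eisenstein integers. -/
theorem eis_dissection_three : eis = V 3 eis + 6 * X * V 3 coreSeries := by
  have h : (6 : ℚ⟦X⟧) * X * V 3 coreSeries = X * V 3 eisShift + X * V 3 eisShift := by
    rw [eisShift_eq_coreSeries]; simp only [map_mul, map_ofNat]; ring
  rw [h, ← add_assoc]
  conv_lhs => rw [eis]
  -- The classes of x + y mod 3: the first is the sublattice similar to the whole with norm ratio 3,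
  -- and the third is the negative of the second.
  rw [gf_union_three proper_eis (fun v : ℤ × ℤ => (2 * v.1 - v.2, v.1 + v.2))
    (fun v : ℤ × ℤ => (2 * v.1 - v.2, v.1 + v.2 + 1))
    (fun v : ℤ × ℤ => (-(2 * v.1 - v.2), -(v.1 + v.2 + 1)))]
  · congr 1
    · congr 1
      · rw [eis, ← gf_eq_V proper_eis 3 fun v => rfl]
        exact gf_congr (fun v => by simp only [Function.comp_apply]; push_cast; ring) fun v => rfl
      · rw [eisShift, ← gf_eq_X_mul_V proper_eisShift 3 fun v => rfl]
        exact gf_congr (fun v => by simp only [Function.comp_apply]; push_cast; ring) fun v => rfl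
    · rw [eisShift, ← gf_eq_X_mul_V proper_eisShift 3 fun v => rfl]
      exact gf_congr (fun v => by simp only [Function.comp_apply]; push_cast; ring) fun v => rfl
  · rintro ⟨x, y⟩ ⟨z, w⟩ h
    simp only [Prod.mk.injEq] at h ⊢
    omega
  · rintro ⟨x, y⟩ ⟨z, w⟩ h
    simp only [Prod.mk.injEq] at h ⊢
    omega
  · rintro ⟨x, y⟩ ⟨z, w⟩ h
    simp only [Prod.mk.injEq] at h ⊢
    omega
  · rintro ⟨x, y⟩ ⟨z, w⟩ h
    simp only [Prod.mk.injEq] at h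
    omega
  · rintro ⟨x, y⟩ ⟨z, w⟩ h
    simp only [Prod.mk.injEq] at h
    omega
  · rintro ⟨x, y⟩ ⟨z, w⟩ h
    simp only [Prod.mk.injEq] at h
    omega
  · rintro ⟨x, y⟩
    have : (x + y) % 3 = 0 ∨ (x + y) % 3 = 1 ∨ (x + y) % 3 = 2 := by omega
    rcases this with h | h | h
    · refine Or.inl ⟨((x + y) / 3, y - (x + y) / 3), ?_⟩
      simp only [Prod.mk.injEq]
      omega
    · refine Or.inr (Or.inl ⟨((x + y) / 3, y - 1 - (x + y) / 3), ?_⟩)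
      simp only [Prod.mk.injEq]
      omega
    · refine Or.inr (Or.inr ⟨(-(x + y) / 3, -y - 1 - (-(x + y)) / 3), ?_⟩)
      simp only [Prod.mk.injEq]
      omega

/-- The cube of `ψ`, from the decomposition of `ℤ³` along its diagonal. -/
theorem psi_cube : 4 * psi ^ 3 = V 3 psi * eis + 3 * coreSeries * pent := by
  have h : (2 : ℚ⟦X⟧) * (4 * psi ^ 3) = 2 * (V 3 psi * eis + 3 * coreSeries * pent) := by
    have h1 : (2 : ℚ⟦X⟧) * (4 * psi ^ 3) = 2 * psi * (2 * psi) * (2 * psi) := by ring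
    have h2 : (2 : ℚ⟦X⟧) * (V 3 psi * eis + 3 * coreSeries * pent) =
        V 3 (2 * psi) * eis + pent * eisShift + pent * eisShift := by
      rw [eisShift_eq_coreSeries]; simp only [map_mul, map_ofNat]; ring
    have p0 := proper_zero_one
    have p3 : Proper fun n : ℤ => ((3 : ℕ) : ℤ) * (1 * (n * (n - 1)) + 2 * 0 * n) :=
      (proper_theta le_rfl (by norm_num) (by norm_num : (0:ℤ) < 3)).congr
        fun n => by push_cast; ring
    rw [h1, h2, ← J_zero_one, J, gf_mul p0 p0, gf_mul (p0.add p0) p0,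
      ← gf_eq_V p0 3 fun n => rfl, eis, gf_mul p3 proper_eis, pent, J, eisShift,
      gf_mul proper_pent proper_eisShift,
      -- The classes of the coordinate sum mod 3; the third map is the second followed by n ↦ 1 - n
      -- in each coordinate.
      gf_union_three ((p0.add p0).add p0)
        (fun v : ℤ × ℤ × ℤ => ((v.1 + v.2.1, v.1 - v.2.2), v.1 - v.2.1 + v.2.2))
        (fun v : ℤ × ℤ × ℤ => ((v.1 + 1 + v.2.2, v.1 - v.2.1), v.1 + v.2.1 - v.2.2))
        (fun v : ℤ × ℤ × ℤ => ((-v.1 - v.2.2, 1 - v.1 + v.2.1), 1 - v.1 - v.2.1 + v.2.2))]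
    · congr 1
      · congr 1
        · exact gf_congr (fun v => by simp only [Function.comp_apply]; push_cast; ring)
            fun v => by simp
        · exact gf_congr (fun v => by simp only [Function.comp_apply]; push_cast; ring)
            fun v => by simp
      · exact gf_congr (fun v => by simp only [Function.comp_apply]; push_cast; ring)
          fun v => by simp
    · rintro ⟨x, y, z⟩ ⟨x', y', z'⟩ h
      simp only [Prod.mk.injEq] at h ⊢
      omega
    · rintro ⟨x, y, z⟩ ⟨x', y', z'⟩ h
      simp only [Prod.mk.injEq] at h ⊢
      omega
    · rintro ⟨x, y, z⟩ ⟨x', y', z'⟩ h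
      simp only [Prod.mk.injEq] at h ⊢
      omega
    · rintro ⟨x, y, z⟩ ⟨x', y', z'⟩ h
      simp only [Prod.mk.injEq] at h
      omega
    · rintro ⟨x, y, z⟩ ⟨x', y', z'⟩ h
      simp only [Prod.mk.injEq] at h
      omega
    · rintro ⟨x, y, z⟩ ⟨x', y', z'⟩ h
      simp only [Prod.mk.injEq] at h
      omega
    · rintro ⟨⟨x, y⟩, z⟩
      obtain ⟨t, ht⟩ : ∃ t, t = (x + y + z) / 3 := ⟨_, rfl⟩
      have : x + y + z = 3 * t ∨ x + y + z = 3 * t + 1 ∨ x + y + z = 3 * t + 2 := by omega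
      rcases this with h | h | h
      · refine Or.inl ⟨(t, x - t, t - y), ?_⟩
        simp only [Prod.mk.injEq]
        omega
      · refine Or.inr (Or.inl ⟨(t, t - y, x - t - 1), ?_⟩)
        simp only [Prod.mk.injEq]
        omega
      · refine Or.inr (Or.inr ⟨(-t, y - 1 - t, t - x), ?_⟩)
        simp only [Prod.mk.injEq]
        omega
  exact mul_left_cancel₀ two_ne_zero_series h

end Dissections

/-! ### 2-dissections -/

section TwoDissections

theorem Proper.nat_mul {ι : Type*} {w : ι → ℤ} (hw : Proper w) (k : ℕ) [NeZero k] :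
    Proper fun i => (k : ℤ) * w i := by
  have hk : (1 : ℤ) ≤ k := by exact_mod_cast NeZero.one_le
  refine ⟨fun i => mul_nonneg (by omega) (hw.nonneg i), fun i => (hw.even i).mul_left _,
    fun n => (hw.finite_le n).subset fun i hi => ?_⟩
  rw [Set.mem_ofPred_eq] at hi ⊢
  nlinarith [hw.nonneg i]

/-- The series `φ(q) = ∑ q ^ (n ^ 2)`, the sum being over all integers. -/
noncomputable def phi : ℚ⟦X⟧ := J 1 1 2

theorem proper_phi : Proper fun n : ℤ => 2 * (n * (n - 1)) + 2 * 1 * n :=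
  proper_theta (by norm_num) (by norm_num) (by norm_num)

theorem phi_mul_phi :
    phi * V 3 phi = gf (fun v : ℤ × ℤ => 2 * (v.1 ^ 2 + 3 * v.2 ^ 2)) fun _ => 1 := by
  rw [phi, J, ← gf_eq_V proper_phi 3 fun _ => rfl, gf_mul proper_phi (proper_phi.nat_mul 3)]
  exact gf_congr (fun v => by push_cast; ring) fun v => by simp

theorem proper_phi_mul_phi : Proper fun v : ℤ × ℤ => 2 * (v.1 ^ 2 + 3 * v.2 ^ 2) :=
  (proper_phi.add (proper_phi.nat_mul 3)).congr fun v => by push_cast; ring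

theorem psi_mul_psi : gf (fun v : ℤ × ℤ => 2 * (v.1 * (v.1 - 1)) + 6 * (v.2 * (v.2 - 1)))
    (fun _ => 1) = 4 * V 2 (psi * V 3 psi) := by
  have h : (4 : ℚ⟦X⟧) * V 2 (psi * V 3 psi) = V 2 (2 * psi) * V 2 (V 3 (2 * psi)) := by
    simp only [map_mul, map_ofNat]; ring
  rw [h, ← J_zero_one, J, ← gf_eq_V proper_zero_one 3 fun _ => rfl,
    ← gf_eq_V proper_zero_one 2 fun _ => rfl, ← gf_eq_V (proper_zero_one.nat_mul 3) 2 fun _ => rfl,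
    gf_mul (proper_zero_one.nat_mul 2) ((proper_zero_one.nat_mul 3).nat_mul 2)]
  exact gf_congr (fun v => by push_cast; ring) fun v => by simp

theorem proper_psi_mul_psi :
    Proper fun v : ℤ × ℤ => 2 * (v.1 * (v.1 - 1)) + 6 * (v.2 * (v.2 - 1)) :=
  ((proper_zero_one.nat_mul 2).add ((proper_zero_one.nat_mul 3).nat_mul 2)).congr
    fun v => by push_cast; ring

theorem psi_mul_pent : gf (fun v : ℤ × ℤ => 2 * (v.1 * (v.1 - 1)) + 2 * (v.2 * (3 * v.2 - 1)))
    (fun _ => 1) = 2 * V 2 (psi * pent) := by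
  have h : (2 : ℚ⟦X⟧) * V 2 (psi * pent) = V 2 (2 * psi) * V 2 pent := by
    simp only [map_mul, map_ofNat]; ring
  rw [h, ← J_zero_one, J, pent, J,
    ← gf_eq_V proper_zero_one 2 fun _ => rfl, ← gf_eq_V proper_pent 2 fun _ => rfl,
    gf_mul (proper_zero_one.nat_mul 2) (proper_pent.nat_mul 2)]
  exact gf_congr (fun v => by push_cast; ring) fun v => by simp

theorem proper_psi_mul_pent :
    Proper fun v : ℤ × ℤ => 2 * (v.1 * (v.1 - 1)) + 2 * (v.2 * (3 * v.2 - 1)) :=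
  ((proper_zero_one.nat_mul 2).add (proper_pent.nat_mul 2)).congr fun v => by push_cast; ring

/-- Complete the square, x² - xy + y² = (x - y/2)² + 3(y/2)², and split by the parity of y. -/
theorem eis_eq_phi_add_psi : eis = phi * V 3 phi + 4 * X * V 2 (psi * V 3 psi) := by
  rw [phi_mul_phi, mul_comm (4 : ℚ⟦X⟧), mul_assoc, ← psi_mul_psi]
  have := gf_add_weight _ (fun _ => 1) proper_psi_mul_psi.nonneg 1
  rw [pow_one] at this
  rw [← this, eis, gf_union_two proper_eis (fun v : ℤ × ℤ => (v.1 + v.2, 2 * v.2))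
    (fun v : ℤ × ℤ => (v.1 + v.2 - 1, 2 * v.2 - 1))]
  · congr 1
    · exact gf_congr (fun v => by simp only [Function.comp_apply]; ring) fun v => rfl
    · exact gf_congr (fun v => by simp only [Function.comp_apply]; push_cast; ring) fun v => rfl
  · rintro ⟨x, y⟩ ⟨z, w⟩ h
    simp only [Prod.mk.injEq] at h ⊢
    omega
  · rintro ⟨x, y⟩ ⟨z, w⟩ h
    simp only [Prod.mk.injEq] at h ⊢
    omega
  · rintro ⟨x, y⟩ ⟨z, w⟩ h
    simp only [Prod.mk.injEq] at h
    omega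
  · rintro ⟨x, y⟩
    rcases Int.even_or_odd' y with ⟨k, rfl | rfl⟩
    · refine Or.inl ⟨(x - k, k), ?_⟩
      simp only [Prod.mk.injEq, and_true]
      omega
    · refine Or.inr ⟨(x - k, k + 1), ?_⟩
      simp only [Prod.mk.injEq]
      omega

/-- Split x² + 3y² by the parity of x + y: the even class is 4 times the Eisenstein norm form. -/
theorem phi_mul_phi_eq_eis_add :
    phi * V 3 phi = V 2 (V 2 eis) +
      gf (fun v : ℤ × ℤ => 2 * ((2 * v.1 + 1 - v.2) ^ 2 + 3 * v.2 ^ 2)) fun _ => 1 := by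
  rw [phi_mul_phi, gf_union_two proper_phi_mul_phi (fun v : ℤ × ℤ => (v.2 - 2 * v.1, v.2))
    (fun v : ℤ × ℤ => (2 * v.1 + 1 - v.2, v.2))]
  · congr 1
    rw [eis, ← gf_eq_V proper_eis 2 fun _ => rfl, ← gf_eq_V (proper_eis.nat_mul 2) 2 fun _ => rfl]
    exact gf_congr (fun v => by simp only [Function.comp_apply]; push_cast; ring) fun v => rfl
  · rintro ⟨x, y⟩ ⟨z, w⟩ h
    simp only [Prod.mk.injEq] at h ⊢
    omega
  · rintro ⟨x, y⟩ ⟨z, w⟩ h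
    simp only [Prod.mk.injEq] at h ⊢
    omega
  · rintro ⟨x, y⟩ ⟨z, w⟩ h
    simp only [Prod.mk.injEq] at h
    omega
  · rintro ⟨x, y⟩
    rcases Int.even_or_odd' (x + y) with ⟨k, h | h⟩
    · refine Or.inl ⟨(y - k, y), ?_⟩
      simp only [Prod.mk.injEq, and_true]
      omega
    · refine Or.inr ⟨(k, y), ?_⟩
      simp only [Prod.mk.injEq, and_true]
      omega

/-- The three nonzero classes of the Eisenstein integers mod 2 have equal theta series. The left
side is one of them, and the other two make up the ψ term of `eis_eq_phi_add_psi`. -/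
theorem odd_class_eq :
    gf (fun v : ℤ × ℤ => 2 * ((2 * v.1 + 1 - v.2) ^ 2 + 3 * v.2 ^ 2)) (fun _ => 1) =
      2 * X * V 2 (psi * V 3 psi) := by
  set O := gf (fun v : ℤ × ℤ => 2 * ((2 * v.1 + 1 - v.2) ^ 2 + 3 * v.2 ^ 2)) fun _ => 1 with hO
  have h : X * gf (fun v : ℤ × ℤ => 2 * (v.1 * (v.1 - 1)) + 6 * (v.2 * (v.2 - 1)))
      (fun _ => 1) = O + O := by
    rw [gf_union_two proper_psi_mul_psi (fun v : ℤ × ℤ => (2 * v.2 - v.1, v.1 + 1))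
      (fun v : ℤ × ℤ => (v.1 - 2 * v.2 + 1, v.1 + 1)), mul_add, hO]
    · congr 1
      · rw [← pow_one (X : ℚ⟦X⟧), ← gf_add_weight ((fun v : ℤ × ℤ =>
          2 * (v.1 * (v.1 - 1)) + 6 * (v.2 * (v.2 - 1))) ∘ fun v : ℤ × ℤ => (2 * v.2 - v.1, v.1 + 1)) _
          fun v => proper_psi_mul_psi.nonneg _]
        exact gf_congr (fun v => by simp only [Function.comp_apply]; push_cast; ring) fun v => rfl
      · rw [← pow_one (X : ℚ⟦X⟧), ← gf_add_weight ((fun v : ℤ × ℤ =>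
          2 * (v.1 * (v.1 - 1)) + 6 * (v.2 * (v.2 - 1))) ∘ fun v : ℤ × ℤ => (v.1 - 2 * v.2 + 1, v.1 + 1)) _
          fun v => proper_psi_mul_psi.nonneg _]
        exact gf_congr (fun v => by simp only [Function.comp_apply]; push_cast; ring) fun v => rfl
    · rintro ⟨x, y⟩ ⟨z, w⟩ h
      simp only [Prod.mk.injEq] at h ⊢
      omega
    · rintro ⟨x, y⟩ ⟨z, w⟩ h
      simp only [Prod.mk.injEq] at h ⊢
      omega
    · rintro ⟨x, y⟩ ⟨z, w⟩ h
      simp only [Prod.mk.injEq] at h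
      omega
    · rintro ⟨x, y⟩
      rcases Int.even_or_odd' (x + y) with ⟨k, h | h⟩
      · refine Or.inr ⟨(y - 1, y - k), ?_⟩
        simp only [Prod.mk.injEq]
        omega
      · refine Or.inl ⟨(y - 1, k), ?_⟩
        simp only [Prod.mk.injEq]
        omega
  rw [psi_mul_psi] at h
  apply mul_left_cancel₀ two_ne_zero_series
  rw [two_mul O, ← h]
  ring

theorem phi_mul_phi_dissection :
    phi * V 3 phi = V 2 (V 2 eis) + 2 * X * V 2 (psi * V 3 psi) := by
  rw [phi_mul_phi_eq_eis_add, odd_class_eq]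

theorem eis_dissection_two : eis = V 2 (V 2 eis) + 6 * X * V 2 (psi * V 3 psi) := by
  conv_lhs => rw [eis_eq_phi_add_psi, phi_mul_phi_dissection]
  ring

/-- The rotation of order 3 that preserves the form x² - xy + y² + y fixes the class (1, 0) mod 2
and permutes the other three. Those three have the common series `K`, which equals `V 2 (psi *
pent)`; the fixed class gives the term in q⁴. -/
theorem eisShift_dissection_two : eisShift = 3 * V 2 (psi * pent) + X * V 2 (V 2 eisShift) := by
  set K := gf (fun v : ℤ × ℤ => 8 * (v.1 ^ 2 - v.1 * v.2 + v.2 ^ 2) + 4 * v.2) fun _ => 1 with hK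
  have h1 : eisShift = gf (fun v : ℤ × ℤ => 2 * (v.1 ^ 2 - 2 * v.1 * v.2 + 4 * v.2 ^ 2 +
      2 * v.2)) (fun _ => 1) + 2 * V 2 (psi * pent) := by
    rw [← psi_mul_pent, eisShift, gf_union_two proper_eisShift (fun v : ℤ × ℤ => (v.1, 2 * v.2))
      (fun v : ℤ × ℤ => (v.2 - 1 + v.1, 2 * v.2 - 1))]
    · congr 1
      · exact gf_congr (fun v => by simp only [Function.comp_apply]; ring) fun v => rfl
      · exact gf_congr (fun v => by simp only [Function.comp_apply]; ring) fun v => rfl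
    · rintro ⟨x, y⟩ ⟨z, w⟩ h
      simp only [Prod.mk.injEq] at h ⊢
      omega
    · rintro ⟨x, y⟩ ⟨z, w⟩ h
      simp only [Prod.mk.injEq] at h ⊢
      omega
    · rintro ⟨x, y⟩ ⟨z, w⟩ h
      simp only [Prod.mk.injEq] at h
      omega
    · rintro ⟨x, y⟩
      rcases Int.even_or_odd' y with ⟨k, rfl | rfl⟩
      · exact Or.inl ⟨(x, k), rfl⟩
      · refine Or.inr ⟨(x - k, k + 1), ?_⟩
        simp only [Prod.mk.injEq]
        omega
  have h2 : gf (fun v : ℤ × ℤ => 2 * (v.1 ^ 2 - 2 * v.1 * v.2 + 4 * v.2 ^ 2 +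
      2 * v.2)) (fun _ => 1) = K + X * V 2 (V 2 eisShift) := by
    have hp : Proper fun v : ℤ × ℤ => 2 * (v.1 ^ 2 - 2 * v.1 * v.2 + 4 * v.2 ^ 2 + 2 * v.2) :=
      (proper_eisShift.comp (f := fun v : ℤ × ℤ => (v.1, 2 * v.2)) (by
        rintro ⟨x, y⟩ ⟨z, w⟩ h
        simp only [Prod.mk.injEq] at h ⊢
        omega)).congr fun v => by simp only [Function.comp_apply]; ring
    rw [gf_union_two hp (fun v : ℤ × ℤ => (2 * v.1, v.2))
      (fun v : ℤ × ℤ => (2 * v.2 + 1, v.1)), hK]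
    · congr 1
      · exact gf_congr (fun v => by simp only [Function.comp_apply]; ring) fun v => rfl
      · rw [eisShift, ← gf_eq_V proper_eisShift 2 fun _ => rfl,
          ← gf_eq_X_mul_V (proper_eisShift.nat_mul 2) 2 fun _ => rfl]
        exact gf_congr (fun v => by simp only [Function.comp_apply]; push_cast; ring) fun v => rfl
    · rintro ⟨x, y⟩ ⟨z, w⟩ h
      simp only [Prod.mk.injEq] at h ⊢
      omega
    · rintro ⟨x, y⟩ ⟨z, w⟩ h
      simp only [Prod.mk.injEq] at h ⊢
      omega
    · rintro ⟨x, y⟩ ⟨z, w⟩ h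
      simp only [Prod.mk.injEq] at h
      omega
    · rintro ⟨x, y⟩
      rcases Int.even_or_odd' x with ⟨k, rfl | rfl⟩
      · exact Or.inl ⟨(k, y), rfl⟩
      · exact Or.inr ⟨(y, k), rfl⟩
  have h3 : 2 * V 2 (psi * pent) = K + K := by
    rw [← psi_mul_pent, gf_union_two proper_psi_mul_pent
      (fun v : ℤ × ℤ => (-v.1 - v.2, v.1 - v.2)) (fun v : ℤ × ℤ => (2 * v.2 - v.1 + 1, -v.1)), hK]
    · congr 1
      · exact gf_congr (fun v => by simp only [Function.comp_apply]; ring) fun v => rfl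
      · exact gf_congr (fun v => by simp only [Function.comp_apply]; ring) fun v => rfl
    · rintro ⟨x, y⟩ ⟨z, w⟩ h
      simp only [Prod.mk.injEq] at h ⊢
      omega
    · rintro ⟨x, y⟩ ⟨z, w⟩ h
      simp only [Prod.mk.injEq] at h ⊢
      omega
    · rintro ⟨x, y⟩ ⟨z, w⟩ h
      simp only [Prod.mk.injEq] at h
      omega
    · rintro ⟨x, y⟩
      rcases Int.even_or_odd' (x + y) with ⟨k, h | h⟩
      · refine Or.inl ⟨(-x + k, -k), ?_⟩
        simp only [Prod.mk.injEq]
        omega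
      · refine Or.inr ⟨(-y, k - y), ?_⟩
        simp only [Prod.mk.injEq]
        omega
  have h4 : V 2 (psi * pent) = K := by
    apply mul_left_cancel₀ two_ne_zero_series
    rw [h3, two_mul]
  conv_lhs => rw [h1, h2]
  rw [h4]
  ring

/-- The `2`-dissection of the generating series of `3`-cores. -/
theorem coreSeries_dissection :
    coreSeries = V 2 (psi * pent) + X * V 2 (V 2 coreSeries) := by
  have h3 : (3 : ℚ⟦X⟧) ≠ 0 := fun h => by
    simpa [map_ofNat] using congrArg (constantCoeff (R := ℚ)) h
  apply mul_left_cancel₀ h3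
  have h := eisShift_dissection_two
  rw [eisShift_eq_coreSeries] at h
  simp only [map_mul, map_ofNat] at h ⊢
  linear_combination h

end TwoDissections

/-! ### Coefficient extraction, orders of vanishing, and theta relations -/

section Algebra

theorem V_comm (k l : ℕ) [NeZero k] [NeZero l] (F : ℚ⟦X⟧) : V k (V l F) = V l (V k F) := by
  rw [V, V, ← expand_mul k (NeZero.ne k) l (NeZero.ne l), ← expand_mul l (NeZero.ne l) k (NeZero.ne k)]
  simp only [Nat.mul_comm k l]

theorem V_X (k : ℕ) [NeZero k] : V k (X : ℚ⟦X⟧) = X ^ k := by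
  rw [V, expand_X]

theorem constantCoeff_V (k : ℕ) [NeZero k] (F : ℚ⟦X⟧) :
    constantCoeff (V k F) = constantCoeff F := by
  rw [V, constantCoeff_expand]

theorem coeff_V_mul (k : ℕ) [NeZero k] (F : ℚ⟦X⟧) (n : ℕ) : coeff (k * n) (V k F) = coeff n F := by
  rw [V, coeff_expand_mul]

theorem coeff_X_pow_mul_V (k r n : ℕ) [NeZero k] (F : ℚ⟦X⟧) (h : ∀ m, n ≠ k * m + r) :
    coeff n (X ^ r * V k F) = 0 := by
  rw [coeff_X_pow_mul']
  split_ifs with hr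
  · rw [V, coeff_expand, if_neg]
    rintro ⟨m, hm⟩
    exact h m (by omega)
  · rfl

theorem coeff_X_pow_mul_V_self (k r n : ℕ) [NeZero k] (F : ℚ⟦X⟧) :
    coeff (k * n + r) (X ^ r * V k F) = coeff n F := by
  rw [coeff_X_pow_mul, coeff_V_mul]

theorem V_injective (k : ℕ) [NeZero k] : Function.Injective (V k) := by
  intro F G h
  ext n
  rw [← coeff_V_mul k F, h, coeff_V_mul]

theorem coeff_two_dissection (A B : ℚ⟦X⟧) (n : ℕ) :
    coeff (2 * n) (V 2 A + X * V 2 B) = coeff n A ∧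
      coeff (2 * n + 1) (V 2 A + X * V 2 B) = coeff n B := by
  have e1 := coeff_X_pow_mul_V 2 1 (2 * n) B (by intro m; omega)
  have e2 := coeff_X_pow_mul_V_self 2 1 n B
  have e3 := coeff_X_pow_mul_V 2 0 (2 * n + 1) A (by intro m; omega)
  rw [pow_one] at e1 e2
  rw [pow_zero, one_mul] at e3
  rw [map_add, map_add, e1, e2, e3, coeff_V_mul, add_zero, zero_add]
  exact ⟨rfl, rfl⟩

theorem coeff_three_dissection (A B D : ℚ⟦X⟧) (n : ℕ) :
    coeff (3 * n + 1) (V 3 A + X * V 3 B + X ^ 2 * V 3 D) = coeff n B ∧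
      coeff (3 * n + 2) (V 3 A + X * V 3 B + X ^ 2 * V 3 D) = coeff n D := by
  have a1 := coeff_X_pow_mul_V 3 0 (3 * n + 1) A (by intro m; omega)
  have a2 := coeff_X_pow_mul_V 3 0 (3 * n + 2) A (by intro m; omega)
  have b1 := coeff_X_pow_mul_V_self 3 1 n B
  have b2 := coeff_X_pow_mul_V 3 1 (3 * n + 2) B (by intro m; omega)
  have d1 := coeff_X_pow_mul_V 3 2 (3 * n + 1) D (by intro m; omega)
  have d2 := coeff_X_pow_mul_V_self 3 2 n D
  rw [pow_zero, one_mul] at a1 a2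
  rw [pow_one] at b1 b2
  simp only [map_add, a1, a2, b1, b2, d1, d2, add_zero, zero_add, and_self]

theorem ne_zero_of_constantCoeff {F : ℚ⟦X⟧} (h : constantCoeff F ≠ 0) : F ≠ 0 := by
  rintro rfl
  simp at h

/-- The engine of the vanishing arguments: the substitution multiplies the order of vanishing by
`k`, while a factor with nonzero constant term does not change it. -/
theorem X_pow_dvd_V {k m : ℕ} [NeZero k] {F : ℚ⟦X⟧} (h : X ^ m ∣ F) : X ^ (k * m) ∣ V k F := by
  obtain ⟨G, rfl⟩ := h
  rw [map_mul, map_pow, V_X, ← pow_mul]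
  exact dvd_mul_right _ _

theorem X_pow_dvd_of_mul {m : ℕ} {F G : ℚ⟦X⟧} (hG : constantCoeff G ≠ 0) (h : X ^ m ∣ G * F) :
    X ^ m ∣ F :=
  (isUnit_iff_constantCoeff.mpr hG.isUnit).dvd_mul_left.mp h

theorem eq_zero_of_X_pow_dvd {F : ℚ⟦X⟧} (h : ∀ n, X ^ n ∣ F) : F = 0 := by
  ext n
  exact X_pow_dvd_iff.mp (h (n + 1)) n (Nat.lt_succ_self n)

theorem constantCoeff_J (ε : ℚ) {a b : ℤ} (ha : 0 < a) (hab : a < b) :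
    constantCoeff (J ε a b) = 1 := by
  rw [← coeff_zero_eq_constantCoeff_apply, J, coeff_gf, finsum_eq_single _ (0 : ℤ)]
  · simp
  · intro n hn
    refine if_neg fun h => ?_
    rcases lt_or_gt_of_ne hn with h0 | h0
    · push_cast at h
      nlinarith [mul_pos (by omega : 0 < b - a) (by omega : 0 < -n),
        mul_nonneg (by omega : 0 ≤ -n - 1) (by omega : 0 ≤ -n)]
    · push_cast at h
      nlinarith [mul_pos ha h0, mul_nonneg (by omega : 0 ≤ n - 1) (by omega : 0 ≤ n)]

theorem constantCoeff_psi : constantCoeff psi = 1 := constantCoeff_J _ (by norm_num) (by norm_num)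

theorem constantCoeff_pent : constantCoeff pent = 1 := constantCoeff_J _ (by norm_num) (by norm_num)

theorem constantCoeff_phi : constantCoeff phi = 1 := constantCoeff_J _ (by norm_num) (by norm_num)

theorem psi_ne_zero : psi ≠ 0 := ne_zero_of_constantCoeff (by simp [constantCoeff_psi])

theorem V_psi_ne_zero (k : ℕ) [NeZero k] : V k psi ≠ 0 :=
  ne_zero_of_constantCoeff (by simp [constantCoeff_V, constantCoeff_psi])

theorem V_two_coreSeries : V 2 coreSeries =
    gf (fun v : ℤ × ℤ => 2 * 2 * (3 * (v.1 ^ 2 + v.1 * v.2 + v.2 ^ 2) + v.1 + 2 * v.2))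
      fun _ => 1 := by
  have h : Proper fun v : ℤ × ℤ => 2 * (3 * (v.1 ^ 2 + v.1 * v.2 + v.2 ^ 2) + v.1 + 2 * v.2) :=
    (proper_eisCore one_pos).congr fun v => by ring
  rw [coreSeries, ← gf_eq_V h 2 fun _ => rfl]
  exact gf_congr (fun v => by push_cast; ring) fun _ => rfl

theorem V_J_of_eq (k : ℕ) [NeZero k] (ε : ℚ) {a b c d : ℤ} (ha : 0 ≤ a) (hab : a ≤ b) (hb : 0 < b)
    (hc : c = k * a) (hd : d = k * b) : J ε c d = V k (J ε a b) := by
  rw [hc, hd, J_scale k ε ha hab hb]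

/-- `ψ(q) ^ 2 = φ(q) ψ(q ^ 2)`. -/
theorem psi_sq : psi ^ 2 = phi * V 2 psi := by
  have h := theta_mul_two 1 one_ne_zero le_rfl zero_le_one one_pos
  norm_num at h
  rw [V_J_of_eq 2 1 le_rfl zero_le_one one_pos (by norm_num) (by norm_num), J_zero_one,
    ← phi, ← psi, map_mul, map_ofNat] at h
  apply mul_left_cancel₀ two_ne_zero_series
  linear_combination -h

theorem V_three_psi_mul_pent_sq : V 3 psi * pent ^ 2 = psi * coreSeries := by
  have h := theta_mul_three 1 one_ne_zero le_rfl zero_le_one one_pos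
  norm_num at h
  rw [V_J_of_eq 3 1 le_rfl zero_le_one one_pos (by norm_num) (by norm_num), J_zero_one,
    ← pent, show (2 : ℤ) = 3 - 1 by norm_num, J_reflect 1 (Or.inl rfl), ← pent, map_mul,
    map_ofNat, show (3 : ℤ) - 1 = 2 by norm_num, ← coreSeries] at h
  apply mul_left_cancel₀ two_ne_zero_series
  linear_combination h

/-- The series `J 1 1 6` is auxiliary: this relation and the next serve to eliminate it. -/
theorem theta_six_mul_pent : J 1 1 6 * V 2 pent = pent * V 3 psi := by
  have h := theta_mul_two 1 one_ne_zero zero_le_one (by norm_num : (1 : ℤ) ≤ 3) (by norm_num)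
  norm_num at h
  rw [show (4 : ℤ) = 6 - 2 by norm_num, J_reflect 1 (Or.inl rfl)] at h
  have e1 : J 1 2 6 = V 2 pent := V_J_of_eq 2 1 zero_le_one (by norm_num) (by norm_num)
    (by norm_num) (by norm_num)
  have e2 : J 1 9 12 = V 3 psi := V_J_of_eq 3 1 (by norm_num) (by norm_num) (by norm_num)
    (by norm_num) (by norm_num)
  rwa [e1, e2, ← pent] at h

theorem theta_six_sq_mul_phi : J 1 1 6 ^ 2 * V 3 phi = phi * V 2 coreSeries := by
  have h := theta_mul_three 1 one_ne_zero zero_le_one (by norm_num : (1 : ℤ) ≤ 2) (by norm_num)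
  rw [← V_two_coreSeries] at h
  norm_num at h
  have e : J 1 3 6 = V 3 phi := V_J_of_eq 3 1 zero_le_one (by norm_num) (by norm_num)
    (by norm_num) (by norm_num)
  rw [show (5 : ℤ) = 6 - 1 by norm_num, J_reflect 1 (Or.inl rfl), e, ← phi] at h
  linear_combination h

/-- Eliminating `J 1 1 6`, which one of the relations contains squared, yields only the square of
this identity; constant terms then fix the sign. -/
theorem V_two_coreSeries_mul_psi : V 2 coreSeries * psi = pent * V 3 psi ^ 2 := by
  have h1 := theta_six_sq_mul_phi
  have h2 := congrArg (V 2) V_three_psi_mul_pent_sq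
  have h3 := theta_six_mul_pent
  have h4 := psi_sq
  have h5 := congrArg (V 3) psi_sq
  simp only [map_mul, map_pow] at h2 h5
  rw [V_comm 3 2] at h5
  have hsq : (V 2 coreSeries * psi) ^ 2 = (pent * V 3 psi ^ 2) ^ 2 := by
    apply mul_left_cancel₀ (pow_ne_zero 2 psi_ne_zero)
    have e1 : (V 2 coreSeries * psi) ^ 2 * (phi * V 2 psi) =
        (phi * V 2 coreSeries) * (V 2 psi * V 2 coreSeries) * psi ^ 2 := by ring
    have e2 : J 1 1 6 ^ 2 * V 3 phi * (V 2 (V 3 psi) * V 2 pent ^ 2) * psi ^ 2 =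
        (J 1 1 6 * V 2 pent) ^ 2 * (V 3 phi * V 2 (V 3 psi)) * psi ^ 2 := by ring
    rw [mul_comm, h4, e1, ← h1, ← h2, e2, h3, ← h5, ← h4]
    ring
  rw [sq_eq_sq_iff_eq_or_eq_neg] at hsq
  refine hsq.resolve_right fun h => ?_
  have hc : constantCoeff coreSeries = 1 := by
    have := congrArg constantCoeff V_three_psi_mul_pent_sq
    simpa [constantCoeff_V, constantCoeff_psi, constantCoeff_pent] using this.symm
  have := congrArg constantCoeff h
  simp [constantCoeff_V, constantCoeff_psi, constantCoeff_pent, hc] at this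
  norm_num at this

theorem pent_mul_V_two_coreSeries : pent * V 2 coreSeries = V 3 psi * coreSeries := by
  apply mul_left_cancel₀ psi_ne_zero
  linear_combination pent * V_two_coreSeries_mul_psi + V 3 psi * V_three_psi_mul_pent_sq

end Algebra

/-! ### Level-six identities and the two coefficient extractions -/

section Cubic

theorem constantCoeff_eis : constantCoeff eis = 1 := by
  rw [eis_eq_phi_add_psi]
  simp [constantCoeff_V, constantCoeff_phi]

/-- Two theta identities of level six, equivalent to `ψ(q)³ / ψ(q³) = (a(q) + a(q²)) / 2` and
`q ψ(q³)³ / ψ(q) = (a(q) - a(q²)) / 6`, proved together: the two differences of both sides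
satisfy recursions under `3`-dissection which force them to vanish. -/
theorem psi_cube_and_eis : 2 * psi ^ 3 = V 3 psi * (eis + V 2 eis) ∧
    (eis - V 2 eis) * psi = 6 * X * V 3 psi ^ 3 := by
  set D := 2 * psi ^ 3 - V 3 psi * (eis + V 2 eis) with hD
  set E := (eis - V 2 eis) * psi - 6 * X * V 3 psi ^ 3 with hE
  -- `D'` and `E'` are the 3-dissection components for which `D` is `V 3 D'` and `E` is `V 3 E' + X
  -- * V 3 D`. Up to factors with nonzero constant term they are combinations of `D` and `E` again
  -- (`rD`, `rE`), which closes the recursion.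
  set D' := 2 * pent ^ 3 + 2 * X * V 3 psi ^ 3 - psi * (eis + V 2 eis) with hD'
  set E' := (eis - V 2 eis) * pent - 6 * X * V 2 coreSeries * V 3 psi with hE'
  have a1 := V_three_psi_mul_pent_sq
  have a2 := V_two_coreSeries_mul_psi
  have a3 := pent_mul_V_two_coreSeries
  have v1 := congrArg (V 3) a1
  have v2 := congrArg (V 3) a2
  have v3 := congrArg (V 3) a3
  have c := psi_cube
  have e2 : V 2 eis = V 3 (V 2 eis) + 6 * X ^ 2 * V 3 (V 2 coreSeries) := by
    have := congrArg (V 2) eis_dissection_three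
    simpa only [map_mul, map_add, map_ofNat, V_X, V_comm 2 3] using this
  have rD : 3 * V 3 psi * D' = 4 * psi * D - V 3 psi * E := by
    rw [hD', hD, hE]
    linear_combination 6 * pent * a1 - 2 * psi * c
  have rE : psi * E' = pent * E := by
    rw [hE', hE]
    linear_combination -6 * X * V 3 psi * a2
  have dD : D = V 3 D' := by
    have h3 := congrArg (· ^ 3) psi_dissection
    simp only [hD, hD', map_mul, map_add, map_sub, map_pow, map_ofNat, V_X] at v1 v2 h3 ⊢
    linear_combination 2 * h3 - V 3 psi * (eis_dissection_three + e2) + 6 * X * v1 - 6 * X ^ 2 * v2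
  have dE : E = V 3 E' + X * V 3 D := by
    have h3 := congrArg (· ^ 3) psi_dissection
    have vc := congrArg (V 3) c
    simp only [hE, hE', hD, map_mul, map_add, map_sub, map_pow, map_ofNat, V_X] at v3 vc ⊢
    linear_combination psi * (eis_dissection_three - e2) + (V 3 eis + 6 * X * V 3 coreSeries -
      V 3 (V 2 eis) - 6 * X ^ 2 * V 3 (V 2 coreSeries)) * psi_dissection - 6 * X ^ 2 * v3 - 2 * X * vc
  -- An order of vanishing m of `D` and `E` passes to `D'` and `E'`, and `V 3` raises it to 3m; the
  -- induction uses only 3m ≥ m + 1.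
  have key : ∀ n, X ^ (n + 1) ∣ D ∧ X ^ (n + 1) ∣ E := by
    intro n
    induction n with
    | zero =>
      rw [pow_one, X_dvd_iff, X_dvd_iff, hD, hE]
      norm_num [constantCoeff_V, constantCoeff_psi, constantCoeff_eis, map_ofNat]
    | succ n ih =>
      have hle : n + 1 + 1 ≤ 3 * (n + 1) := by omega
      have d1 : X ^ (n + 1) ∣ D' := by
        refine X_pow_dvd_of_mul (G := 3 * V 3 psi) ?_ ?_
        · simp [constantCoeff_V, constantCoeff_psi, map_ofNat]
        · rw [rD]
          exact (ih.1.mul_left _).sub (ih.2.mul_left _)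
      have d2 : X ^ (n + 1) ∣ E' := by
        refine X_pow_dvd_of_mul (G := psi) ?_ ?_
        · simp [constantCoeff_psi]
        · rw [rE]
          exact ih.2.mul_left _
      constructor
      · rw [dD]
        exact (pow_dvd_pow _ hle).trans (X_pow_dvd_V d1)
      · rw [dE]
        exact ((pow_dvd_pow _ hle).trans (X_pow_dvd_V d2)).add
          (((pow_dvd_pow _ hle).trans (X_pow_dvd_V ih.1)).mul_left _)
  have zD : D = 0 := eq_zero_of_X_pow_dvd fun n => (pow_dvd_pow _ n.le_succ).trans (key n).1
  have zE : E = 0 := eq_zero_of_X_pow_dvd fun n => (pow_dvd_pow _ n.le_succ).trans (key n).2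
  exact ⟨sub_eq_zero.mp zD, sub_eq_zero.mp zE⟩

/-- The pair `psi_cube_and_eis` is a linear system for `eis` and `V 2 eis`; this and the next lemma
are its solution. -/
theorem eis_mul_psi : eis * (psi * V 3 psi) = psi ^ 4 + 3 * X * V 3 psi ^ 4 := by
  obtain ⟨h1, h2⟩ := psi_cube_and_eis
  apply mul_left_cancel₀ two_ne_zero_series
  linear_combination V 3 psi * h2 - psi * h1

theorem V_two_eis_mul_psi : V 2 eis * (psi * V 3 psi) = psi ^ 4 - 3 * X * V 3 psi ^ 4 := by
  obtain ⟨h1, h2⟩ := psi_cube_and_eis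
  apply mul_left_cancel₀ two_ne_zero_series
  linear_combination -V 3 psi * h2 - psi * h1

theorem psi_pow_four : psi ^ 4 = pent ^ 3 * V 3 psi + X * V 3 psi ^ 4 := by
  have h3 : (3 : ℚ⟦X⟧) ≠ 0 := ne_zero_of_constantCoeff (by simp [map_ofNat])
  apply mul_left_cancel₀ h3
  linear_combination psi * psi_cube + eis_mul_psi - 3 * pent * V_three_psi_mul_pent_sq

/-- The coefficients of the cube of the generating series of `3`-cores at the exponents `6 n + 4`. -/
theorem coeff_coreSeries_cube (n : ℕ) :
    coeff (6 * n + 4) (coreSeries ^ 3) = coeff n (24 * (psi ^ 4 * coreSeries)) := by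
  have a1 := V_three_psi_mul_pent_sq
  have a2 := V_two_coreSeries_mul_psi
  have hcube : coreSeries ^ 3 = V 2 ((psi * pent) ^ 3 + 3 * X * (psi * pent) * V 2 coreSeries ^ 2) +
      X * V 2 (3 * (psi * pent) ^ 2 * V 2 coreSeries + X * V 2 coreSeries ^ 3) := by
    have := congrArg (· ^ 3) coreSeries_dissection
    simp only [map_add, map_mul, map_pow, map_ofNat, V_X] at this ⊢
    linear_combination this
  -- The even part factors through `eis`, so the known 3-dissections of `eis` and ψ apply to it.
  have heven : (psi * pent) ^ 3 + 3 * X * (psi * pent) * V 2 coreSeries ^ 2 =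
      eis * (psi ^ 4 - X * V 3 psi ^ 4) := by
    have h1 : (psi * pent) ^ 2 + 3 * X * V 2 coreSeries ^ 2 = eis * coreSeries := by
      apply mul_left_cancel₀ (mul_ne_zero psi_ne_zero (mul_ne_zero psi_ne_zero (V_psi_ne_zero 3)))
      linear_combination (psi ^ 4 + 3 * X * V 3 psi ^ 4) * a1 +
        3 * X * V 3 psi * (V 2 coreSeries * psi + pent * V 3 psi ^ 2) * a2 -
        psi * coreSeries * eis_mul_psi
    linear_combination psi * pent * h1 - eis * pent * a1 - eis * psi_pow_four
  have hthree : eis * (psi ^ 4 - X * V 3 psi ^ 4) =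
      V 3 (eis * (pent ^ 4 + 4 * X * pent * V 3 psi ^ 3) +
        36 * X * coreSeries * pent ^ 2 * V 3 psi ^ 2) +
      X * V 3 (eis * (4 * pent ^ 3 * V 3 psi + X * V 3 psi ^ 4 - psi ^ 4) +
        6 * coreSeries * (pent ^ 4 + 4 * X * pent * V 3 psi ^ 3)) +
      X ^ 2 * V 3 (24 * (psi ^ 4 * coreSeries)) := by
    -- After reduction the class 2 mod 3 is 18(ψ⁴ - qψ(q³)⁴) + 6(ψ⁴ + 3qψ(q³)⁴), times `coreSeries`;
    -- the terms in ψ(q³)⁴ cancel.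
    have h2 : 24 * (psi ^ 4 * coreSeries) = eis * (6 * pent ^ 2 * V 3 psi ^ 2) +
        6 * coreSeries * (4 * pent ^ 3 * V 3 psi + X * V 3 psi ^ 4 - psi ^ 4) := by
      linear_combination -6 * eis * V 3 psi * a1 - 6 * coreSeries * eis_mul_psi +
        24 * coreSeries * psi_pow_four
    rw [h2]
    have h4 := congrArg (· ^ 4) psi_dissection
    simp only [map_add, map_sub, map_mul, map_pow, map_ofNat, V_X] at h4 ⊢
    linear_combination (V 3 eis + 6 * X * V 3 coreSeries) * h4 +
      (psi ^ 4 - X * V 3 psi ^ 4) * eis_dissection_three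
  rw [show 6 * n + 4 = 2 * (3 * n + 2) by ring, hcube, (coeff_two_dissection _ _ _).1, heven,
    hthree, (coeff_three_dissection _ _ _ _).2]

/-- The coefficients of `φ(q)³ φ(q³)³` at the exponents `12 n + 10`. -/
theorem coeff_phi_mul_phi_cube (n : ℕ) :
    coeff (12 * n + 10) ((phi * V 3 phi) ^ 3) = coeff n (144 * (psi ^ 4 * coreSeries)) := by
  have a1 := V_three_psi_mul_pent_sq
  have a2 := V_two_coreSeries_mul_psi
  have hcube : (phi * V 3 phi) ^ 3 =
      V 2 (V 2 eis ^ 3 + 12 * X * V 2 eis * (psi * V 3 psi) ^ 2) +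
      X * V 2 (6 * V 2 eis ^ 2 * (psi * V 3 psi) + 8 * X * (psi * V 3 psi) ^ 3) := by
    have := congrArg (· ^ 3) phi_mul_phi_dissection
    simp only [map_add, map_mul, map_pow, map_ofNat, V_X] at this ⊢
    linear_combination this
  have e2 : V 2 eis = V 3 (V 2 eis) + 6 * X ^ 2 * V 3 (V 2 coreSeries) := by
    have := congrArg (V 2) eis_dissection_three
    simpa only [map_mul, map_add, map_ofNat, V_X, V_comm 2 3] using this
  -- Of the even part only 12q times this series matters: `V 2 eis ^ 3` has no odd exponents and the
  -- needed exponent is 6n+5.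
  have hthree : V 2 eis * (psi * V 3 psi) ^ 2 =
      V 3 (V 2 eis * (psi * pent) ^ 2 + 12 * X * V 2 coreSeries * pent * psi ^ 2 * V 3 psi) +
      X * V 3 (2 * (psi * pent * psi ^ 4)) +
      X ^ 2 * V 3 (V 2 eis * (psi * V 3 psi) ^ 2 + 6 * V 2 coreSeries * (psi * pent) ^ 2) := by
    have h1 : 2 * (psi * pent * psi ^ 4) = 2 * V 2 eis * (psi * pent) * (psi * V 3 psi) +
        6 * X * V 2 coreSeries * (psi * V 3 psi) ^ 2 := by
      linear_combination -2 * psi * pent * V_two_eis_mul_psi - 6 * X * psi * V 3 psi ^ 2 * a2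
    rw [h1]
    have h2 := congrArg (· ^ 2) psi_dissection
    simp only [map_add, map_mul, map_pow, map_ofNat, V_X] at h2 ⊢
    linear_combination (psi * V 3 psi) ^ 2 * e2 +
      V 3 psi ^ 2 * (V 3 (V 2 eis) + 6 * X ^ 2 * V 3 (V 2 coreSeries)) * h2
  have htwo : 2 * (2 * (psi * pent * psi ^ 4)) =
      V 2 (((eis + V 2 eis) ^ 2 + 36 * X * (psi * V 3 psi) ^ 2) * coreSeries) +
      X * V 2 (2 * (12 * (psi ^ 4 * coreSeries))) := by
    -- The doubling allows `2 * psi ^ 3` to be used squared, and the result is (`eis` + `V 2 eis`)²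
    -- times a series in q², whose odd part is read off from `eis_dissection_two`.
    have h1 : 2 * (2 * (psi * pent * psi ^ 4)) = (eis + V 2 eis) ^ 2 * V 2 coreSeries := by
      apply mul_left_cancel₀ (pow_ne_zero 2 (V_psi_ne_zero 3))
      linear_combination -(2 * psi ^ 3 + V 3 psi * (eis + V 2 eis)) * V 2 coreSeries *
        (-psi_cube_and_eis.1) - 4 * psi ^ 5 * a2
    have h2 : 2 * (12 * (psi ^ 4 * coreSeries)) =
        12 * (eis + V 2 eis) * (psi * V 3 psi) * coreSeries := by
      linear_combination 12 * psi * coreSeries * psi_cube_and_eis.1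
    rw [h1, h2]
    have h3 := eis_dissection_two
    have h4 := congrArg (· ^ 2) eis_dissection_two
    simp only [map_add, map_mul, map_pow, map_ofNat, V_X] at h3 h4 ⊢
    linear_combination V 2 coreSeries * (h4 + 2 * V 2 eis * h3)
  have hodd : coeff (2 * n + 1) (2 * (psi * pent * psi ^ 4)) =
      coeff n (12 * (psi ^ 4 * coreSeries)) := by
    have h := (coeff_two_dissection _ _ _).2.symm.trans (congrArg (coeff (2 * n + 1)) htwo.symm)
    rw [← map_ofNat (C (R := ℚ)) 2, coeff_C_mul, coeff_C_mul] at h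
    exact (mul_left_cancel₀ (by norm_num) h).symm
  have h1 : coeff (6 * n + 5) (V 2 eis ^ 3 : ℚ⟦X⟧) = 0 := by
    have := coeff_X_pow_mul_V 2 0 (6 * n + 5) (eis ^ 3) (by intro m; omega)
    rwa [pow_zero, one_mul, map_pow] at this
  have h2 : (12 * X * V 2 eis * (psi * V 3 psi) ^ 2 : ℚ⟦X⟧) =
      X * (C 12 * (V 2 eis * (psi * V 3 psi) ^ 2)) := by
    rw [map_ofNat]; ring
  have h3 : (144 * (psi ^ 4 * coreSeries) : ℚ⟦X⟧) = C 12 * (12 * (psi ^ 4 * coreSeries)) := by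
    rw [map_ofNat]; ring
  rw [show 12 * n + 10 = 2 * (6 * n + 5) by ring, hcube, (coeff_two_dissection _ _ _).1, map_add,
    h1, zero_add, h2, coeff_succ_X_mul, coeff_C_mul, hthree,
    show 6 * n + 4 = 3 * (2 * n + 1) + 1 by ring, (coeff_three_dissection _ _ _ _).1, hodd, h3,
    coeff_C_mul]

end Cubic

/-! ### Infinite products and Gauss's identities -/

section Products

open scoped PowerSeries.WithPiTopology

/-- Euler's pentagonal number theorem. -/
theorem f_one : f 1 = J (-1) 1 3 := by
  have h : f 1 = pentagonalSeries ℚ := by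
    rw [f]
    simp only [one_mul]
    exact WithPiTopology.tprod_one_sub_X_pow ℚ
  rw [h]
  ext n
  rw [J, coeff_gf]
  have hiff : ∀ k : ℤ, 3 * (k * (k - 1)) + 2 * 1 * k = 2 * (n : ℤ) ↔ pentagonal k = n := by
    intro k
    have := two_mul_natCast_pentagonal k
    rw [← Nat.cast_inj (R := ℤ)]
    constructor <;> intro h <;> linarith
  simp only [hiff]
  by_cases hn : n ∈ Set.range pentagonal
  · obtain ⟨k, rfl⟩ := hn
    rw [coeff_pentagonalSeries_pentagonal, finsum_eq_single _ k]
    · rw [if_pos rfl, Int.coe_negOnePow]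
      rcases Int.even_or_odd k with h | h
      · rw [h.neg_one_zpow, (Int.natAbs_even.mpr h).neg_one_pow]
      · rw [h.neg_one_zpow, (Int.natAbs_odd.mpr h).neg_one_pow]
    · intro l hl
      rw [if_neg]
      exact fun h => hl (pentagonal_injective h)
  · rw [coeff_pentagonalSeries_eq_zero ℚ hn]
    refine (finsum_eq_zero_of_forall_eq_zero fun k => if_neg fun h => hn ⟨k, h⟩).symm

/-- Needed to carry the substitution through the infinite product in `f_eq_V`. -/
theorem continuous_V (k : ℕ) [NeZero k] : Continuous (V k) := by
  rw [continuous_iff_continuousAt]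
  intro F
  rw [ContinuousAt, WithPiTopology.tendsto_iff_coeff_tendsto]
  intro d
  by_cases h : k ∣ d
  · obtain ⟨m, rfl⟩ := h
    simp only [coeff_V_mul]
    exact (WithPiTopology.continuous_coeff ℚ m).tendsto F
  · simp only [V, coeff_expand, if_neg h]
    exact tendsto_const_nhds

theorem f_eq_V (k : ℕ) [NeZero k] : f k = V k (f 1) := by
  have h := (multipliable_f le_rfl).hasProd.map (V k) (continuous_V k)
  rw [f, f, ← h.tprod_eq]
  refine tprod_congr fun n => ?_
  simp only [Function.comp_apply, map_sub, map_one, map_pow, V_X, one_mul, pow_mul]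

theorem constantCoeff_f (k : ℕ) [NeZero k] : constantCoeff (f k) = 1 := by
  rw [f_eq_V, constantCoeff_V, f_one]
  exact constantCoeff_J _ (by norm_num) (by norm_num)

theorem f_ne_zero (k : ℕ) [NeZero k] : f k ≠ 0 :=
  ne_zero_of_constantCoeff (by simp [constantCoeff_f])

/-- The series `φ(-q)`. -/
noncomputable def phiNeg : ℚ⟦X⟧ := J (-1) 1 2

theorem constantCoeff_phiNeg : constantCoeff phiNeg = 1 :=
  constantCoeff_J _ (by norm_num) (by norm_num)

theorem pent_mul_f : pent * f 1 = f 2 * V 3 phiNeg := by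
  have h := theta_mul_neg zero_le_one (by norm_num : (1 : ℤ) ≤ 3) (by norm_num)
  norm_num at h
  have e1 : J (-1) 2 6 = f 2 := by
    rw [f_eq_V, f_one]
    exact V_J_of_eq 2 (-1) zero_le_one (by norm_num) (by norm_num) (by norm_num) (by norm_num)
  have e2 : J (-1) 3 6 = V 3 phiNeg :=
    V_J_of_eq 3 (-1) zero_le_one (by norm_num) (by norm_num) (by norm_num) (by norm_num)
  rwa [e1, e2, ← pent, ← f_one] at h

theorem theta_neg_six_mul_f : J (-1) 1 6 * f 2 = f 1 * V 3 psi := by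
  have h := theta_mul_two (-1) (by norm_num) zero_le_one (by norm_num : (1 : ℤ) ≤ 3) (by norm_num)
  norm_num at h
  have e1 : J (-1) 2 6 = f 2 := by
    rw [f_eq_V, f_one]
    exact V_J_of_eq 2 (-1) zero_le_one (by norm_num) (by norm_num) (by norm_num) (by norm_num)
  have e2 : J 1 9 12 = V 3 psi := V_J_of_eq 3 1 (by norm_num) (by norm_num) (by norm_num)
    (by norm_num) (by norm_num)
  rwa [show (4 : ℤ) = 6 - 2 by norm_num, J_reflect (-1) (Or.inr rfl), e1, e2, ← f_one] at h

theorem theta_neg_six_sq_mul_phiNeg :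
    J (-1) 1 6 ^ 2 * V 3 phiNeg = phiNeg * V 2 coreSeries := by
  have h := theta_mul_three (-1) (by norm_num) zero_le_one (by norm_num : (1 : ℤ) ≤ 2)
    (by norm_num)
  rw [← V_two_coreSeries] at h
  norm_num at h
  have e : J (-1) 3 6 = V 3 phiNeg :=
    V_J_of_eq 3 (-1) zero_le_one (by norm_num) (by norm_num) (by norm_num) (by norm_num)
  rw [show (5 : ℤ) = 6 - 1 by norm_num, J_reflect (-1) (Or.inr rfl), e, ← phiNeg] at h
  linear_combination h

theorem phi_mul_phiNeg : phi * phiNeg = V 2 phiNeg ^ 2 := by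
  have h := theta_mul_neg zero_le_one (by norm_num : (1 : ℤ) ≤ 2) (by norm_num)
  norm_num at h
  have e : J (-1) 2 4 = V 2 phiNeg :=
    V_J_of_eq 2 (-1) zero_le_one (by norm_num) (by norm_num) (by norm_num) (by norm_num)
  rw [e, ← phi, ← phiNeg] at h
  rw [h, sq]

/-- Eliminate `J (-1) 1 6`, `pent` and `V 2 coreSeries` among the preceding relations; the
level-three factors then cancel. -/
theorem psi_mul_f_cube : psi * f 1 ^ 3 = f 2 ^ 3 * phiNeg := by
  have h3 : V 3 phiNeg ≠ 0 :=
    ne_zero_of_constantCoeff (by simp [constantCoeff_V, constantCoeff_phiNeg])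
  apply mul_left_cancel₀ (mul_ne_zero h3 (pow_ne_zero 2 (V_psi_ne_zero 3)))
  have a2 := V_two_coreSeries_mul_psi
  have b1 := pent_mul_f
  have b2 := congrArg (· ^ 2) theta_neg_six_mul_f
  have b3 := theta_neg_six_sq_mul_phiNeg
  simp only [mul_pow] at b2
  linear_combination -psi * f 1 * V 3 phiNeg * b2 + psi * f 1 * f 2 ^ 2 * b3 +
    f 1 * f 2 ^ 2 * phiNeg * a2 + f 2 ^ 2 * phiNeg * V 3 psi ^ 2 * b1

theorem eq_of_cube_eq {F G : ℚ⟦X⟧} (hF : constantCoeff F = 1) (hG : constantCoeff G = 1)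
    (h : F ^ 3 = G ^ 3) : F = G := by
  have h' : (F ^ 2 + F * G + G ^ 2) * (F - G) = 0 := by linear_combination h
  refine sub_eq_zero.mp ((mul_eq_zero.mp h').resolve_left (ne_zero_of_constantCoeff ?_))
  simp only [map_add, map_mul, map_pow, hF, hG]
  norm_num

/-- Gauss's identity `φ(-q) = f₁² / f₂`. -/
theorem phiNeg_mul_f : phiNeg * f 2 = f 1 ^ 2 := by
  have h2 : f 2 = V 2 (f 1) := f_eq_V 2
  have hV : constantCoeff (V 2 (f 1)) = 1 := by rw [constantCoeff_V, constantCoeff_f]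
  -- With R = φ(-q)f₂/f₁² this says R(q)³ = R(q²)³; constant terms 1 allow the cube root to be
  -- taken.
  have hcube : (phiNeg * f 2 * V 2 (f 1 ^ 2)) ^ 3 = (f 1 ^ 2 * V 2 (phiNeg * f 2)) ^ 3 := by
    have c1 := psi_mul_f_cube
    have c2 := congrArg (V 2) psi_mul_f_cube
    have c3 := phi_mul_phiNeg
    have c4 := psi_sq
    have c5 := congrArg (· ^ 2) psi_mul_f_cube
    simp only [map_mul, map_pow, ← h2] at c2 c5 ⊢
    linear_combination -phiNeg * f 2 ^ 3 * c5 + f 1 ^ 6 * f 2 ^ 3 * phiNeg * c4 +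
      f 1 ^ 6 * f 2 ^ 3 * V 2 psi * c3 + f 1 ^ 6 * V 2 phiNeg ^ 2 * c2
  have heq := eq_of_cube_eq (by simp [h2, constantCoeff_V, constantCoeff_phiNeg, constantCoeff_f])
    (by simp [h2, constantCoeff_V, constantCoeff_phiNeg, constantCoeff_f]) hcube
  -- R(q) = R(q²), written for the difference of numerator and denominator: its order of vanishing
  -- is at least doubled, so it is zero.
  have hrec : V 2 (f 1 ^ 2) * (phiNeg * f 2 - f 1 ^ 2) = f 1 ^ 2 * V 2 (phiNeg * f 2 - f 1 ^ 2) := by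
    rw [map_sub]
    linear_combination heq
  have key : ∀ n, X ^ (n + 1) ∣ phiNeg * f 2 - f 1 ^ 2 := by
    intro n
    induction n with
    | zero =>
      rw [pow_one, X_dvd_iff]
      simp [constantCoeff_phiNeg, constantCoeff_f]
    | succ n ih =>
      refine X_pow_dvd_of_mul (G := V 2 (f 1 ^ 2)) ?_ ?_
      · simp [constantCoeff_V, constantCoeff_f]
      · rw [hrec]
        exact ((pow_dvd_pow _ (by omega : n + 1 + 1 ≤ 2 * (n + 1))).trans
          (X_pow_dvd_V ih)).mul_left _
  exact sub_eq_zero.mp (eq_zero_of_X_pow_dvd fun n => (pow_dvd_pow _ n.le_succ).trans (key n))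

/-- Gauss's identity `ψ(q) = f₂² / f₁`. -/
theorem psi_mul_f : psi * f 1 = f 2 ^ 2 := by
  apply mul_left_cancel₀ (pow_ne_zero 2 (f_ne_zero 1))
  linear_combination psi_mul_f_cube + f 2 ^ 2 * phiNeg_mul_f

/-- The generating series of `3`-cores is `f₃³ / f₁`. -/
theorem coreSeries_mul_f : coreSeries * f 1 = f 3 ^ 3 := by
  -- The theta relations give `V 2 coreSeries` in terms of ψ and `pent`, so the identity is proved
  -- at q².
  apply V_injective 2
  have h2 : V 2 (f 1) = f 2 := (f_eq_V 2).symm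
  have h3 : V 3 (f 1) = f 3 := (f_eq_V 3).symm
  have c1 := congrArg (V 3) phiNeg_mul_f
  have c2 := congrArg (V 3) psi_mul_f
  have h6 : V 3 (f 2) = V 2 (f 3) := by rw [← h2, ← h3, V_comm]
  simp only [map_mul, map_pow, h2, h3, h6] at c1 c2 ⊢
  apply mul_left_cancel₀ (mul_ne_zero (pow_ne_zero 3 (f_ne_zero 2))
    (mul_ne_zero (pow_ne_zero 2 (f_ne_zero 3)) (h6 ▸ ne_zero_of_constantCoeff (F := V 3 (f 2))
      (by simp [constantCoeff_V, constantCoeff_f]))))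
  have c3 := congrArg (· ^ 2) c2
  simp only [mul_pow] at c3
  linear_combination
    -V 2 coreSeries * f 2 ^ 2 * f 3 ^ 2 * V 2 (f 3) * psi_mul_f +
    f 1 * f 2 ^ 2 * f 3 ^ 2 * V 2 (f 3) * V_two_coreSeries_mul_psi +
    f 2 ^ 2 * f 3 ^ 2 * V 2 (f 3) * V 3 psi ^ 2 * pent_mul_f +
    f 2 ^ 3 * f 3 ^ 2 * V 3 psi ^ 2 * c1 + f 2 ^ 3 * f 3 ^ 2 * c3

theorem psi_pow_four_mul_coreSeries :
    psi ^ 4 * coreSeries = f 2 ^ 8 * f 3 ^ 3 * (f 1 ^ 5)⁻¹ := by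
  rw [PowerSeries.eq_mul_inv_iff_mul_eq (by simp [constantCoeff_f])]
  have h := congrArg (· ^ 4) psi_mul_f
  simp only [mul_pow] at h
  linear_combination coreSeries * f 1 * h + f 2 ^ 8 * coreSeries_mul_f

end Products

/-! ### First column hook lengths and cores -/

section BetaSets

/-- The first column hook lengths of the partition with the given list of parts. -/
def betaList : List ℕ → List ℕ
  | [] => []
  | a :: l => (a + l.length) :: betaList l

theorem betaList_injective : Function.Injective betaList := by
  intro l
  induction l with
  | nil =>
    intro l' h
    cases l' with
    | nil => rfl
    | cons b l' => simp [betaList] at h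
  | cons a l ih =>
    intro l' h
    cases l' with
    | nil => simp [betaList] at h
    | cons b l' =>
      simp only [betaList, List.cons.injEq] at h
      obtain rfl := ih h.2
      simpa using h.1

theorem mem_betaList {l : List ℕ} {x : ℕ} :
    x ∈ betaList l ↔ ∃ (i : ℕ) (h : i < l.length), x = l[i] + (l.length - 1 - i) := by
  induction l with
  | nil => simp [betaList]
  | cons a l ih =>
    rw [betaList, List.mem_cons, ih]
    constructor
    · rintro (rfl | ⟨i, h, rfl⟩)
      · exact ⟨0, by simp, by simp⟩
      · refine ⟨i + 1, by simpa using h, ?_⟩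
        simp only [List.getElem_cons_succ, List.length_cons]
        omega
    · rintro ⟨i, h, rfl⟩
      cases i with
      | zero => left; simp
      | succ i =>
        right
        refine ⟨i, by simpa using h, ?_⟩
        simp only [List.getElem_cons_succ, List.length_cons]
        omega

theorem pairwise_betaList {l : List ℕ} (hl : l.Pairwise (· ≥ ·)) :
    (betaList l).Pairwise (· > ·) := by
  induction l with
  | nil => simp [betaList]
  | cons a l ih =>
    rw [List.pairwise_cons] at hl
    rw [betaList, List.pairwise_cons]
    refine ⟨fun b hb => ?_, ih hl.2⟩
    obtain ⟨i, h, rfl⟩ := mem_betaList.mp hb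
    have := hl.1 _ (List.getElem_mem h)
    omega

theorem eq_of_mem_betaList_iff {l l' : List ℕ} (hl : l.Pairwise (· ≥ ·))
    (hl' : l'.Pairwise (· ≥ ·)) (h : ∀ x, x ∈ betaList l ↔ x ∈ betaList l') : l = l' := by
  have p := pairwise_betaList hl
  have p' := pairwise_betaList hl'
  apply betaList_injective
  have hperm : (betaList l).Perm (betaList l') :=
    (List.perm_ext_iff_of_nodup (p.imp fun h => (Nat.ne_of_gt h))
      (p'.imp fun h => (Nat.ne_of_gt h))).mpr h
  exact hperm.eq_of_pairwise (fun a b _ _ h1 h2 => absurd h1 (not_lt.mpr h2.le)) p p'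

/-- The first column hook lengths of a Young diagram. -/
def betaSet (μ : YoungDiagram) : Set ℕ :=
  {x | ∃ i < μ.colLen 0, x = μ.rowLen i + (μ.colLen 0 - 1 - i)}

/-- Rows correspond to elements of the beta set and columns to its gaps; the hook of a cell is the
element of its row minus the gap of its column. -/
theorem hook_add_notMem {μ : YoungDiagram} {i j : ℕ} (h : (i, j) ∈ μ) :
    ∃ y, y ∉ betaSet μ ∧ y + hookNumber μ (i, j) = μ.rowLen i + (μ.colLen 0 - 1 - i) := by
  have h1 := YoungDiagram.mem_iff_lt_colLen.mp h
  have h2 := YoungDiagram.mem_iff_lt_rowLen.mp h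
  have h3 := μ.colLen_anti 0 j (Nat.zero_le _)
  refine ⟨j + (μ.colLen 0 - μ.colLen j), ?_, ?_⟩
  · rintro ⟨k, hk, hy⟩
    have := (YoungDiagram.mem_iff_lt_colLen (μ := μ) (i := k) (j := j)).symm.trans
      YoungDiagram.mem_iff_lt_rowLen
    omega
  · simp only [hookNumber]
    omega

theorem exists_hook_of_notMem {μ : YoungDiagram} {i y : ℕ} (hi : i < μ.colLen 0)
    (hy : y ∉ betaSet μ) (hlt : y < μ.rowLen i + (μ.colLen 0 - 1 - i)) :
    ∃ j, (i, j) ∈ μ ∧ y + hookNumber μ (i, j) = μ.rowLen i + (μ.colLen 0 - 1 - i) := by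
  classical
  -- The first row `m` whose element lies below the gap `y`, or the number of rows if there is none,
  -- is the length of the column sought; that column is then y + m - `μ.colLen 0`.
  have hex : ∃ m, μ.colLen 0 ≤ m ∨ μ.rowLen m + (μ.colLen 0 - 1 - m) < y := ⟨_, Or.inl le_rfl⟩
  obtain ⟨m, hm, hmin⟩ : ∃ m, (μ.colLen 0 ≤ m ∨ μ.rowLen m + (μ.colLen 0 - 1 - m) < y) ∧
      ∀ k < m, k < μ.colLen 0 ∧ y < μ.rowLen k + (μ.colLen 0 - 1 - k) := by
    refine ⟨Nat.find hex, Nat.find_spec hex, fun k hk => ?_⟩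
    have := Nat.find_min hex hk
    push Not at this
    refine ⟨this.1, lt_of_le_of_ne this.2 fun h => hy ⟨k, this.1, h⟩⟩
  have him : i < m := by
    by_contra! h
    have := μ.rowLen_anti m i h
    omega
  have hmr : m ≤ μ.colLen 0 := by
    have := hmin (m - 1) (by omega)
    omega
  have hym : μ.colLen 0 ≤ y + m := by omega
  have hcol : μ.colLen (y + m - μ.colLen 0) = m := by
    apply le_antisymm
    · by_contra! h
      have h1 := YoungDiagram.mem_iff_lt_rowLen.mp (YoungDiagram.mem_iff_lt_colLen.mpr h)
      have h2 := μ.colLen_anti 0 (y + m - μ.colLen 0) (Nat.zero_le _)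
      omega
    · have h1 := hmin (m - 1) (by omega)
      have h2 : (m - 1, y + m - μ.colLen 0) ∈ μ := YoungDiagram.mem_iff_lt_rowLen.mpr (by omega)
      have := YoungDiagram.mem_iff_lt_colLen.mp h2
      omega
  have hmem : (i, y + m - μ.colLen 0) ∈ μ := YoungDiagram.mem_iff_lt_colLen.mpr (by omega)
  refine ⟨_, hmem, ?_⟩
  have := YoungDiagram.mem_iff_lt_rowLen.mp hmem
  simp only [hookNumber]
  omega

/-- A partition is a `t`-core if and only if its set of first column hook lengths is closed under
subtraction of `t`. -/
theorem core_iff_betaSet {t : ℕ} (ht : 0 < t) (μ : YoungDiagram) :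
    (∀ c ∈ μ.cells, ¬ t ∣ hookNumber μ c) ↔ ∀ x ∈ betaSet μ, t ≤ x → x - t ∈ betaSet μ := by
  constructor
  · rintro h x ⟨i, hi, rfl⟩ hx
    by_contra hy
    obtain ⟨j, hj, he⟩ := exists_hook_of_notMem hi hy (by omega)
    exact h (i, j) hj (by rw [show hookNumber μ (i, j) = t by omega])
  · rintro h ⟨i, j⟩ hc ⟨k, hk⟩
    have hc' : (i, j) ∈ μ := hc
    obtain ⟨y, hy, he⟩ := hook_add_notMem hc'
    -- Only hooks equal to `t` are excluded directly; a hook of length t·k is reached by `k`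
    -- successive subtractions.
    have hall : ∀ k y, y + t * k ∈ betaSet μ → y ∈ betaSet μ := by
      intro k
      induction k with
      | zero => exact fun y hy => hy
      | succ k ih =>
        intro y hy
        refine ih y ?_
        have := h _ hy (by rw [mul_add]; omega)
        rwa [show y + t * (k + 1) - t = y + t * k by rw [mul_add]; omega] at this
    refine hy (hall k y ⟨i, ?_, ?_⟩)
    · have := YoungDiagram.mem_iff_lt_colLen.mp hc'
      exact this.trans_le (μ.colLen_anti 0 j (Nat.zero_le _))
    · rw [← hk, he]

theorem betaSet_ofRowLens {l : List ℕ} (hl : l.SortedGE) (hpos : ∀ x ∈ l, 0 < x) (x : ℕ) :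
    x ∈ betaSet (YoungDiagram.ofRowLens l hl) ↔ x ∈ betaList l := by
  have hlen : (YoungDiagram.ofRowLens l hl).colLen 0 = l.length := by
    rw [← YoungDiagram.length_rowLens, YoungDiagram.rowLens_ofRowLens_eq_self hpos]
  rw [mem_betaList, betaSet, Set.mem_ofPred_eq, hlen]
  constructor
  · rintro ⟨i, hi, rfl⟩
    exact ⟨i, hi, by rw [YoungDiagram.rowLen_ofRowLens ⟨i, hi⟩]; rfl⟩
  · rintro ⟨i, hi, rfl⟩
    exact ⟨i, hi, by rw [YoungDiagram.rowLen_ofRowLens ⟨i, hi⟩]; rfl⟩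

end BetaSets

/-! ### Parametrization of 3-cores by pairs of naturals -/

section ThreeCores

/-- The parts of the `3`-core whose set of first column hook lengths consists of
`1, 4, …, 3 c - 2` and `2, 5, …, 3 d - 1`. -/
def coreParts (c d : ℕ) : List ℕ :=
  if c = 0 ∧ d = 0 then [] else
  -- The larger of 3c-2 and 3d-1 is removed; the part is this number minus the c+d-1 remaining ones.
  if d < c then (2 * c - 1 - d) :: coreParts (c - 1) d else (2 * d - c) :: coreParts c (d - 1)
termination_by c + d
decreasing_by all_goals omega

theorem coreParts_induction {p : ℕ → ℕ → List ℕ → Prop} (h0 : p 0 0 [])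
    (h1 : ∀ c d, d < c → p (c - 1) d (coreParts (c - 1) d) →
      p c d ((2 * c - 1 - d) :: coreParts (c - 1) d))
    (h2 : ∀ c d, c ≤ d → 0 < d → p c (d - 1) (coreParts c (d - 1)) →
      p c d ((2 * d - c) :: coreParts c (d - 1))) (c d : ℕ) : p c d (coreParts c d) := by
  induction hn : c + d generalizing c d with
  | zero =>
    obtain ⟨rfl, rfl⟩ : c = 0 ∧ d = 0 := by omega
    rw [coreParts, if_pos ⟨rfl, rfl⟩]
    exact h0
  | succ n ih =>
    rw [coreParts, if_neg (by omega)]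
    split_ifs with h
    · exact h1 c d h (ih _ _ (by omega))
    · exact h2 c d (by omega) (by omega) (ih _ _ (by omega))

theorem length_coreParts (c d : ℕ) : (coreParts c d).length = c + d := by
  refine coreParts_induction (p := fun c d l => l.length = c + d) rfl ?_ ?_ c d
  · intro c d h ih
    rw [List.length_cons, ih]
    omega
  · intro c d h h' ih
    rw [List.length_cons, ih]
    omega

theorem mem_betaList_coreParts (c d x : ℕ) : x ∈ betaList (coreParts c d) ↔
    x % 3 = 1 ∧ x < 3 * c ∨ x % 3 = 2 ∧ x < 3 * d := by
  refine coreParts_induction (p := fun c d l => x ∈ betaList l ↔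
    x % 3 = 1 ∧ x < 3 * c ∨ x % 3 = 2 ∧ x < 3 * d) ?_ ?_ ?_ c d
  · simp [betaList]
  · intro c d h ih
    rw [betaList, List.mem_cons, ih, length_coreParts]
    omega
  · intro c d h h' ih
    rw [betaList, List.mem_cons, ih, length_coreParts]
    omega

theorem le_of_mem_coreParts (c d : ℕ) :
    ∀ a ∈ coreParts c d, 0 < a ∧ a ≤ if d < c then 2 * c - 1 - d else 2 * d - c := by
  refine coreParts_induction (p := fun c d l => ∀ a ∈ l,
    0 < a ∧ a ≤ if d < c then 2 * c - 1 - d else 2 * d - c) (by simp) ?_ ?_ c d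
  · intro c d h ih a ha
    rw [if_pos h]
    rcases List.mem_cons.mp ha with rfl | ha
    · omega
    · have := ih a ha
      split_ifs at this <;> omega
  · intro c d h h' ih a ha
    rw [if_neg (by omega)]
    rcases List.mem_cons.mp ha with rfl | ha
    · omega
    · have := ih a ha
      split_ifs at this <;> omega

theorem pairwise_coreParts (c d : ℕ) : (coreParts c d).Pairwise (· ≥ ·) := by
  refine coreParts_induction (p := fun c d l => l.Pairwise (· ≥ ·)) List.Pairwise.nil ?_ ?_ c d
  · intro c d h ih
    refine List.pairwise_cons.mpr ⟨fun a ha => ?_, ih⟩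
    have := le_of_mem_coreParts _ _ a ha
    split_ifs at this <;> omega
  · intro c d h h' ih
    refine List.pairwise_cons.mpr ⟨fun a ha => ?_, ih⟩
    have := le_of_mem_coreParts _ _ a ha
    split_ifs at this <;> omega

theorem sum_coreParts (c d : ℕ) :
    ((coreParts c d).sum : ℤ) = (c : ℤ) ^ 2 - c * d + (d : ℤ) ^ 2 + d := by
  refine coreParts_induction
    (p := fun c d l => (l.sum : ℤ) = (c : ℤ) ^ 2 - c * d + (d : ℤ) ^ 2 + d) (by simp) ?_ ?_ c d
  · intro c d h ih
    obtain ⟨k, rfl⟩ : ∃ k, c = k + 1 := ⟨c - 1, by omega⟩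
    rw [List.sum_cons, Nat.cast_add, ih, show 2 * (k + 1) - 1 - d = 2 * k + 1 - d by omega,
      Nat.cast_sub (by omega)]
    push_cast [Nat.add_sub_cancel]
    ring
  · intro c d h h' ih
    obtain ⟨k, rfl⟩ : ∃ k, d = k + 1 := ⟨d - 1, by omega⟩
    rw [List.sum_cons, Nat.cast_add, ih, Nat.cast_sub (by omega)]
    push_cast [Nat.add_sub_cancel]
    ring

/-- The `3`-core with parts `coreParts c d`. -/
def corePartition (v : ℕ × ℕ) : Σ m : ℕ, Nat.Partition m :=
  ⟨(coreParts v.1 v.2).sum,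
    { parts := (coreParts v.1 v.2 : Multiset ℕ)
      parts_pos := fun {a} ha => (le_of_mem_coreParts _ _ a (Multiset.mem_coe.mp ha)).1
      parts_sum := Multiset.sum_coe _ }⟩

theorem sigma_partition_ext {p p' : Σ m : ℕ, Nat.Partition m} (h : p.2.parts = p'.2.parts) :
    p = p' := by
  obtain ⟨m, s, hs, rfl⟩ := p
  obtain ⟨m', s', hs', rfl⟩ := p'
  obtain rfl : s = s' := h
  rfl

theorem corePartition_injective : Function.Injective corePartition := by
  rintro ⟨c, d⟩ ⟨c', d'⟩ h
  have hparts : ((coreParts c d : List ℕ) : Multiset ℕ) = coreParts c' d' :=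
    congrArg (fun p : Σ m : ℕ, Nat.Partition m => p.2.parts) h
  have hl : coreParts c d = coreParts c' d' :=
    (Multiset.coe_eq_coe.mp hparts).eq_of_pairwise (fun a b _ _ h1 h2 => le_antisymm h2 h1)
      (pairwise_coreParts _ _) (pairwise_coreParts _ _)
  have key : ∀ x, (x % 3 = 1 ∧ x < 3 * c ∨ x % 3 = 2 ∧ x < 3 * d) ↔
      (x % 3 = 1 ∧ x < 3 * c' ∨ x % 3 = 2 ∧ x < 3 * d') := by
    intro x
    rw [← mem_betaList_coreParts, ← mem_betaList_coreParts, hl]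
  have k1 := key (3 * c + 1)
  have k2 := key (3 * c' + 1)
  have k3 := key (3 * d + 2)
  have k4 := key (3 * d' + 2)
  rw [Prod.mk.injEq]
  omega

theorem exists_lt_iff_of_closed {T : ℕ → Prop} (hT : ∀ k, T (k + 1) → T k)
    (hfin : ∃ k, ¬ T k) : ∃ c, ∀ k, T k ↔ k < c := by
  classical
  refine ⟨Nat.find hfin, fun k => ⟨fun hk => ?_, fun hk => not_not.mp (Nat.find_min hfin hk)⟩⟩
  by_contra! hlt
  have hdown : ∀ j, T (Nat.find hfin + j) → T (Nat.find hfin) := by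
    intro j
    induction j with
    | zero => exact id
    | succ j ih => exact fun h => ih (hT _ h)
  refine Nat.find_spec hfin (hdown (k - Nat.find hfin) ?_)
  rwa [Nat.add_sub_cancel' hlt]

/-- Closure under subtracting 3 makes each residue class an initial segment. Class 0 is empty
because 0 is absent, so two lengths determine everything. -/
theorem exists_coreParts_of_closed {l : List ℕ} (hl : l.Pairwise (· ≥ ·))
    (h0 : 0 ∉ betaList l) (h : ∀ x ∈ betaList l, 3 ≤ x → x - 3 ∈ betaList l) :
    ∃ c d, l = coreParts c d := by
  have hclosed : ∀ r, ∃ c, ∀ k, 3 * k + r ∈ betaList l ↔ k < c := by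
    intro r
    refine exists_lt_iff_of_closed (fun k hk => ?_) ?_
    · have := h _ hk (by omega)
      rwa [show 3 * (k + 1) + r - 3 = 3 * k + r by omega] at this
    · by_contra! hall
      have hinj : Function.Injective fun k => 3 * k + r := fun a b hab => by
        simp only at hab
        omega
      exact Set.infinite_of_injective_forall_mem hinj hall (List.finite_toSet _)
  obtain ⟨b, hb⟩ := hclosed 0
  obtain ⟨c, hc⟩ := hclosed 1
  obtain ⟨d, hd⟩ := hclosed 2
  refine ⟨c, d, eq_of_mem_betaList_iff hl (pairwise_coreParts c d) fun x => ?_⟩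
  rw [mem_betaList_coreParts]
  have hx : x % 3 = 0 ∨ x % 3 = 1 ∨ x % 3 = 2 := by omega
  rcases hx with hx | hx | hx
  · have h1 := hb (x / 3)
    have h2 := hb 0
    rw [show 3 * (x / 3) + 0 = x by omega] at h1
    rw [h1]
    have : ¬ (0 < b) := fun h => h0 (h2.mpr h)
    omega
  · have h1 := hc (x / 3)
    rw [show 3 * (x / 3) + 1 = x by omega] at h1
    rw [h1]
    omega
  · have h1 := hd (x / 3)
    rw [show 3 * (x / 3) + 2 = x by omega] at h1
    rw [h1]
    omega

theorem isCore_three_iff_betaList {n : ℕ} (p : Nat.Partition n) : IsCore 3 p ↔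
    ∀ x ∈ betaList (p.parts.sort (· ≥ ·)), 3 ≤ x → x - 3 ∈ betaList (p.parts.sort (· ≥ ·)) := by
  have hpos : ∀ x ∈ p.parts.sort (· ≥ ·), 0 < x := fun x hx =>
    p.parts_pos ((Multiset.mem_sort _).mp hx)
  rw [IsCore, core_iff_betaSet (by norm_num)]
  simp only [youngDiagram, betaSet_ofRowLens _ hpos]

theorem isCore_three_iff (p : Σ m : ℕ, Nat.Partition m) :
    IsCore 3 p.2 ↔ p ∈ Set.range corePartition := by
  rw [isCore_three_iff_betaList]
  constructor
  · intro h
    have hpos : ∀ x ∈ p.2.parts.sort (· ≥ ·), 0 < x := fun x hx =>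
      p.2.parts_pos ((Multiset.mem_sort _).mp hx)
    have h0 : 0 ∉ betaList (p.2.parts.sort (· ≥ ·)) := by
      intro h0
      obtain ⟨i, hi, he⟩ := mem_betaList.mp h0
      have := hpos _ (List.getElem_mem hi)
      omega
    obtain ⟨c, d, hcd⟩ := exists_coreParts_of_closed (p.2.parts.pairwise_sort (· ≥ ·)) h0 h
    refine ⟨(c, d), sigma_partition_ext ?_⟩
    rw [← Multiset.sort_eq p.2.parts (· ≥ ·), hcd]
    rfl
  · rintro ⟨⟨c, d⟩, rfl⟩
    have hs : (corePartition (c, d)).2.parts.sort (· ≥ ·) = coreParts c d := by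
      refine List.Perm.eq_of_pairwise (fun a b _ _ h1 h2 => le_antisymm h2 h1)
        (Multiset.pairwise_sort _ _) (pairwise_coreParts c d) ?_
      rw [← Multiset.coe_eq_coe, Multiset.sort_eq]
      rfl
    rw [hs]
    intro x
    rw [mem_betaList_coreParts, mem_betaList_coreParts]
    omega

end ThreeCores

/-! ### The coefficients as cardinalities -/

section Counting

/-- The quadrant ℕ² is a fundamental domain for the rotation used in `eisShift_eq_coreSeries`: its
three images tile ℤ². Both series are thus a third of `eisShift`. -/
theorem coreSeries_eq_gf : coreSeries = gf (fun v : ℕ × ℕ =>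
    2 * ((v.1 : ℤ) ^ 2 - v.1 * v.2 + (v.2 : ℤ) ^ 2 + v.2)) fun _ => 1 := by
  have h3 : (3 : ℚ⟦X⟧) ≠ 0 := ne_zero_of_constantCoeff (by simp [map_ofNat])
  apply mul_left_cancel₀ h3
  rw [← eisShift_eq_coreSeries, eisShift,
    gf_union_three proper_eisShift (fun v : ℕ × ℕ => ((v.1 : ℤ), (v.2 : ℤ)))
      (fun v : ℕ × ℕ => (-1 - (v.2 : ℤ), (v.1 : ℤ) - v.2 - 1))
      (fun v : ℕ × ℕ => ((v.2 : ℤ) - v.1, -1 - (v.1 : ℤ)))]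
  · rw [show ∀ F : ℚ⟦X⟧, 3 * F = F + F + F from fun F => by ring]
    congr 1
    · congr 1
      exact gf_congr (fun v => by simp only [Function.comp_apply]; ring) fun v => rfl
    · exact gf_congr (fun v => by simp only [Function.comp_apply]; ring) fun v => rfl
  · rintro ⟨x, y⟩ ⟨z, w⟩ h
    simp only [Prod.mk.injEq] at h ⊢
    omega
  · rintro ⟨x, y⟩ ⟨z, w⟩ h
    simp only [Prod.mk.injEq] at h ⊢
    omega
  · rintro ⟨x, y⟩ ⟨z, w⟩ h
    simp only [Prod.mk.injEq] at h ⊢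
    omega
  · rintro ⟨x, y⟩ ⟨z, w⟩ h
    simp only [Prod.mk.injEq] at h
    omega
  · rintro ⟨x, y⟩ ⟨z, w⟩ h
    simp only [Prod.mk.injEq] at h
    omega
  · rintro ⟨x, y⟩ ⟨z, w⟩ h
    simp only [Prod.mk.injEq] at h
    omega
  · rintro ⟨x, y⟩
    by_cases h1 : 0 ≤ x ∧ 0 ≤ y
    · refine Or.inl ⟨(x.toNat, y.toNat), ?_⟩
      simp only [Prod.mk.injEq]
      omega
    · by_cases h2 : x < 0 ∧ x ≤ y
      · refine Or.inr (Or.inl ⟨((y - x).toNat, (-1 - x).toNat), ?_⟩)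
        simp only [Prod.mk.injEq]
        omega
      · refine Or.inr (Or.inr ⟨((-1 - y).toNat, (x - 1 - y).toNat), ?_⟩)
        simp only [Prod.mk.injEq]
        omega

theorem proper_coreParts :
    Proper fun v : ℕ × ℕ => 2 * ((v.1 : ℤ) ^ 2 - v.1 * v.2 + (v.2 : ℤ) ^ 2 + v.2) := by
  refine proper_eisShift.comp (f := fun v : ℕ × ℕ => ((v.1 : ℤ), (v.2 : ℤ))) ?_
  rintro ⟨x, y⟩ ⟨z, w⟩ h
  simp only [Prod.mk.injEq] at h ⊢
  omega

theorem gf_cube {ι : Type*} {w : ι → ℤ} (hw : Proper w) (n : ℕ) :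
    coeff n (gf w (fun _ => 1) ^ 3) =
      ({v : (ι × ι) × ι | w v.1.1 + w v.1.2 + w v.2 = 2 * (n : ℤ)}.ncard : ℚ) := by
  rw [pow_three', gf_mul hw hw, gf_mul (hw.add hw) hw, ← coeff_gf_one ((hw.add hw).add hw)]
  simp only [mul_one]

theorem coeff_coreSeries_cube_eq_B (n : ℕ) : coeff n (coreSeries ^ 3) = (B 3 n : ℚ) := by
  rw [coreSeries_eq_gf, gf_cube proper_coreParts, B]
  have hinj : Function.Injective fun v : ((ℕ × ℕ) × (ℕ × ℕ)) × (ℕ × ℕ) =>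
      ![corePartition v.1.1, corePartition v.1.2, corePartition v.2] := by
    rintro ⟨⟨x, y⟩, z⟩ ⟨⟨x', y'⟩, z'⟩ h
    have h0 := corePartition_injective (congrFun h 0)
    have h1 := corePartition_injective (congrFun h 1)
    have h2 := corePartition_injective (congrFun h 2)
    simp only at h0 h1 h2
    rw [h0, h1, h2]
  have hsum : ∀ v : ℕ × ℕ, ((corePartition v).2.parts.sum : ℤ) =
      (v.1 : ℤ) ^ 2 - v.1 * v.2 + (v.2 : ℤ) ^ 2 + v.2 := by
    intro v
    rw [← sum_coreParts, (corePartition v).2.parts_sum]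
    rfl
  rw [← Set.ncard_image_of_injective _ hinj]
  congr 2
  ext l
  rw [coreTriples, Set.mem_image, Set.mem_ofPred_eq]
  constructor
  · rintro ⟨v, hv, rfl⟩
    rw [Set.mem_ofPred_eq] at hv
    constructor
    · rw [Fin.sum_univ_three, ← Nat.cast_inj (R := ℤ)]
      simp only [Matrix.cons_val]
      push_cast [hsum]
      linarith
    · intro i
      fin_cases i
      · exact (isCore_three_iff _).mpr ⟨_, rfl⟩
      · exact (isCore_three_iff _).mpr ⟨_, rfl⟩
      · exact (isCore_three_iff _).mpr ⟨_, rfl⟩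
  · rintro ⟨hs, hc⟩
    obtain ⟨x, hx⟩ := (isCore_three_iff _).mp (hc 0)
    obtain ⟨y, hy⟩ := (isCore_three_iff _).mp (hc 1)
    obtain ⟨z, hz⟩ := (isCore_three_iff _).mp (hc 2)
    refine ⟨((x, y), z), ?_, ?_⟩
    · rw [Fin.sum_univ_three, ← hx, ← hy, ← hz, ← Nat.cast_inj (R := ℤ)] at hs
      push_cast [hsum] at hs
      rw [Set.mem_ofPred_eq]
      linarith
    · funext i
      fin_cases i
      · exact hx
      · exact hy
      · exact hz

theorem coeff_phi_cube_eq_omega (n : ℕ) : coeff n ((phi * V 3 phi) ^ 3) = (omega n : ℚ) := by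
  rw [phi_mul_phi, gf_cube proper_phi_mul_phi, omega]
  have hinj : Function.Injective fun v : ((ℤ × ℤ) × (ℤ × ℤ)) × (ℤ × ℤ) =>
      (![v.1.1.1, v.1.2.1, v.2.1], ![v.1.1.2, v.1.2.2, v.2.2]) := by
    rintro ⟨⟨⟨a, b⟩, ⟨c, d⟩⟩, ⟨e, f⟩⟩ ⟨⟨⟨a', b'⟩, ⟨c', d'⟩⟩, ⟨e', f'⟩⟩ h
    have h1 := congrArg Prod.fst h
    have h2 := congrArg Prod.snd h
    have g0 : a = a' := congrFun h1 0
    have g1 : c = c' := congrFun h1 1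
    have g2 : e = e' := congrFun h1 2
    have g3 : b = b' := congrFun h2 0
    have g4 : d = d' := congrFun h2 1
    have g5 : f = f' := congrFun h2 2
    rw [g0, g1, g2, g3, g4, g5]
  rw [← Set.ncard_image_of_injective _ hinj]
  congr 2
  ext ⟨x, y⟩
  rw [representations, Set.mem_image, Set.mem_ofPred_eq]
  simp only [Fin.sum_univ_three]
  constructor
  · rintro ⟨v, hv, h⟩
    rw [Set.mem_ofPred_eq] at hv
    rw [Prod.mk.injEq] at h
    obtain ⟨rfl, rfl⟩ := h
    simp only [Matrix.cons_val]
    linarith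
  · intro h
    refine ⟨(((x 0, y 0), (x 1, y 1)), (x 2, y 2)), ?_, ?_⟩
    · rw [Set.mem_ofPred_eq]
      linarith
    · refine Prod.ext (funext fun i => ?_) (funext fun i => ?_) <;> fin_cases i <;> rfl

end Counting

end CoreTriples

/-! ### The main theorem -/

theorem mainTheorem10 :
    (∀ n : ℕ, CoreTriples.omega (12 * n + 10) = 6 * CoreTriples.B 3 (6 * n + 4)) ∧
    (PowerSeries.mk fun n : ℕ => (CoreTriples.omega (12 * n + 10) : ℚ)) =
      144 * CoreTriples.f 2 ^ 8 * CoreTriples.f 3 ^ 3 * (CoreTriples.f 1 ^ 5)⁻¹ := by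
  constructor
  · intro n
    have h : (CoreTriples.omega (12 * n + 10) : ℚ) = 6 * (CoreTriples.B 3 (6 * n + 4) : ℚ) := by
      rw [← CoreTriples.coeff_phi_cube_eq_omega, ← CoreTriples.coeff_coreSeries_cube_eq_B,
        CoreTriples.coeff_phi_mul_phi_cube, CoreTriples.coeff_coreSeries_cube,
        ← PowerSeries.coeff_C_mul, map_ofNat]
      congr 1
      ring
    exact_mod_cast h
  · rw [mul_assoc, mul_assoc, ← mul_assoc (CoreTriples.f 2 ^ 8),
      ← CoreTriples.psi_pow_four_mul_coreSeries]
    ext n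
    rw [PowerSeries.coeff_mk, ← CoreTriples.coeff_phi_cube_eq_omega,
      CoreTriples.coeff_phi_mul_phi_cube]
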